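/- Let $p$ be a prime and let $V$ be a Noetherian irreducible regular scheme of characteristic $p$ that is $F$-finite (i.e. $\mathcal{O}_V$ is a finite $\mathcal{O}_V^{p}$-module). For a quasi-coherent ideal $\mathcal{J}$ on a regular scheme and a point $x$, let $\nu_x(\mathcal{J})=\sup\{n\ge 0:\mathcal{J}_x\subseteq\mathfrak{m}_x^{n}\}\in\mathbb{N}\cup\{\infty\}$ denote its order at $x$. Let $Z\subset V$ be a regular closed subscheme with ideal $\mathcal{I}(Z)$, let $\mathcal{J}\subseteq\mathcal{O}_V$ be a quasi-coherent ideal, and suppose that for some integer $b\ge 0$ we have $\nu_z(\mathcal{J})=b$ for all $z\in Z$. Let $\pi\colon V_1\to V$ be the blowup of $V$ along $Z$, and let $H_1\subset V_1$ be the exceptional hypersurface, with $\mathcal{I}(H_1)=\mathcal{I}(Z)\mathcal{O}_{V_1}$. Then there is a unique quasi-coherent ideal $\mathcal{J}_1\subseteq\mathcal{O}_{V_1}$ with $$\mathcal{J}\mathcal{O}_{V_1}=\mathcal{I}(H_1)^{b}\,\mathcal{J}_1,$$ and it satisfies $$\nu_{x_1}(\mathcal{J}_1)\le \nu_{\pi(x_1)}(\mathcal{J})\qquad\text{for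 every } x_1\in V_1 .$$ -/

import Mathlib

open CategoryTheory AlgebraicGeometry

universe u

namespace AlgebraicGeometry.Scheme

/-- A scheme of characteristic `p` (`p` a prime) is `F`-finite if the structure sheaf is finite over
its `p`-th powers: on every nonempty affine open set the ring of sections has characteristic `p`
and its Frobenius endomorphism is finite. -/
def IsFFinite (p : ℕ) (X : Scheme.{u}) : Prop :=
  ∀ U : X.affineOpens, Nonempty U.1 →
    ∃ _ : ExpChar Γ(X, U.1) p, (frobenius Γ(X, U.1) p).Finite

/-- All local rings are (Noetherian) regular local rings. -/
def IsRegular (X : Scheme.{u}) : Prop :=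
  ∀ x : X, IsRegularLocalRing (X.presheaf.stalk x)

namespace IdealSheafData

/-- The stalk `J_x`, as an ideal of `𝒪_{X,x}`: it is generated by the germs at `x` of the sections
of `J` on the affine open neighbourhoods of `x`. -/
noncomputable def stalkIdeal {X : Scheme.{u}} (J : X.IdealSheafData) (x : X) :
    Ideal (X.presheaf.stalk x) :=
  ⨆ (U : X.affineOpens) (hx : x ∈ U.1), (J.ideal U).map (X.presheaf.germ U.1 x hx).hom

/-- The order `ν_x(J)` of an ideal at a point: the supremum in `ℕ∞` of the `n` such that
`J_x ⊆ 𝔪_x ^ n`. -/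
noncomputable def orderAt {X : Scheme.{u}} (J : X.IdealSheafData) (x : X) : ℕ∞ :=
  ⨆ (n : ℕ) (_ : J.stalkIdeal x ≤ IsLocalRing.maximalIdeal (X.presheaf.stalk x) ^ n), (n : ℕ∞)

/-- An invertible ideal, that is, the ideal of an effective Cartier divisor: locally generated by
one section that is not a zero divisor. -/
def IsInvertible {X : Scheme.{u}} (I : X.IdealSheafData) : Prop :=
  ∀ x : X, ∃ U : X.affineOpens, x ∈ U.1 ∧
    ∃ f ∈ nonZeroDivisors Γ(X, U.1), I.ideal U = Ideal.span {f}

end IdealSheafData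

/-- `π : X₁ ⟶ X` is the blowup of `X` along the closed subscheme defined by `I`: the extended ideal
`I 𝒪_{X₁}` is invertible and `π` is universal (terminal) among the morphisms with this property. The
exceptional hypersurface is the closed subscheme of `X₁` defined by `I 𝒪_{X₁}`, which is
`I.comap π`. -/
structure IsBlowup {X₁ X : Scheme.{u}} (π : X₁ ⟶ X) (I : X.IdealSheafData) : Prop where
  isInvertible_comap : (I.comap π).IsInvertible
  existsUnique_lift : ∀ {T : Scheme.{u}} (f : T ⟶ X), (I.comap f).IsInvertible →
    ∃! g : T ⟶ X₁, g ≫ π = f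

end AlgebraicGeometry.Scheme

/-!
# Order of an ideal under a permissible blowup

Let `R` be the local ring of `V` at `π x₁` and let `I`, `J` stand for the stalks of `I(Z)` and `𝒥`.
At a point of `Z`, both `R` and `R ⧸ I` are regular local rings, so `I` is a prime ideal generated
by a regular sequence `t` (`IsRegularLocalRing.isRegularlyGenerated`). Such a sequence is
quasi-regular: the graded ring of `I` is a polynomial ring over `R ⧸ I`
(`IsRegularlyGenerated.exists_isQuasiRegular`). Everything else rests on this.

*Divisibility.* By quasi-regularity the powers of the prime `I` are primary
(`IsQuasiRegular.mem_pow_of_mul_mem_pow`). At the generic point of `Z` the ideal `I` is the maximal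
ideal, and order `b` there says that `𝒥` lies in its `b`-th power; hence `𝒥 ≤ I(Z) ^ b`
(`le_pow_of_orderAt_eq`). On the blowup `I(Z)` becomes invertible, so its `b`-th power divides `𝒥`,
uniquely (`IsInvertible.existsUnique_eq_mul`).

*Order.* Off the center, `π` is a local isomorphism. On the center the order of `𝒥` is `b`, so
some `f ∈ J` is not in `𝔪 ^ (b + 1)`; as `J ≤ I ^ b`, it is the value `G (t)` of a form `G` of
degree `b` with a coefficient that is a unit of `R`. On the chart `R[t / t i₀]` the element `f`
equals `t i₀ ^ b` times the dehomogenization of `G`. Modulo `t` that chart is a polynomial ring over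
`R ⧸ I`, and over a residue field the dehomogenized form restricts to a nonzero polynomial of degree
at most `b` on a generic line through the given point. So its order there is at most `b`
(`BlowupChart.le_of_mul_mk_mem_pow`).

The blowup is only known by its universal property, and no gluing of charts is needed to use it.
The stalk map `R → 𝒪_{V₁, x₁}` factors through a local ring `A` of a chart
(`exists_localRing_of_isQuasiRegular`), and the universal property, applied to `Spec A ⟶ V`, gives
a local homomorphism `𝒪_{V₁, x₁} → A` over `R` (`IsBlowup.exists_stalk_hom`). Orders can only grow
along a local homomorphism, so the bound in `A` gives the bound at `x₁`. Off the center the same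
argument works with `A = R`.
-/

/-! ### Quasi-regular families -/

/-- A family `t` of elements of `R` is quasi-regular if every form over `R` that vanishes at `t` has
all its coefficients in the ideal generated by `t`. Equivalently, the associated graded ring of that
ideal `I` is a polynomial ring over `R ⧸ I`. -/
def IsQuasiRegular {R ι : Type*} [CommRing R] (t : ι → R) : Prop :=
  ∀ (n : ℕ) (G : MvPolynomial ι R), G.IsHomogeneous n → MvPolynomial.eval t G = 0 →
    ∀ α, G.coeff α ∈ Ideal.span (Set.range t)

namespace IsQuasiRegular

open MvPolynomial

variable {R ι : Type*} [CommRing R]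

/-- Elements of `I * (t) ^ n` are values at `t` of forms of degree `n` with coefficients in `I`. -/
lemma exists_isHomogeneous_of_mem_mul (t : ι → R) (I : Ideal R) (n : ℕ) {y : R}
    (hy : y ∈ I * Ideal.span (Set.range t) ^ n) :
    ∃ H : MvPolynomial ι R, H.IsHomogeneous n ∧ (∀ α, H.coeff α ∈ I) ∧ eval t H = y := by
  induction hy using Submodule.mul_induction_on' with
  | mem_mul_mem a ha b hb =>
    obtain ⟨B, hB, rfl⟩ := (Ideal.mem_span_pow_iff_exists_isHomogeneous t b).1 hb
    refine ⟨C a * B, hB.C_mul a, fun α ↦ ?_, by simp⟩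
    rw [coeff_C_mul]
    exact I.mul_mem_right _ ha
  | add x _ y _ hx hy =>
    obtain ⟨H, h1, h2, rfl⟩ := hx
    obtain ⟨K, k1, k2, rfl⟩ := hy
    refine ⟨H + K, h1.add k1, fun α ↦ ?_, by simp⟩
    rw [coeff_add]
    exact I.add_mem (h2 α) (k2 α)

/-- The value at `t` of a form of degree `n` with coefficients in `I` lies in `I * (t) ^ n`. -/
lemma eval_mem_mul (t : ι → R) (I : Ideal R) {n : ℕ} {G : MvPolynomial ι R}
    (hG : G.IsHomogeneous n) (h : ∀ α, G.coeff α ∈ I) :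
    eval t G ∈ I * Ideal.span (Set.range t) ^ n := by
  rw [eval_eq]
  refine Ideal.sum_mem _ fun d hd ↦ Ideal.mul_mem_mul (h d) ?_
  have hdeg : ∑ i ∈ d.support, d i = n := by
    rw [← hG.degree_eq_sum_deg_support hd]
  rw [← hdeg, ← Finset.prod_pow_eq_pow_sum]
  exact Ideal.prod_mem_prod fun i _ ↦
    Ideal.pow_mem_pow (Ideal.subset_span (Set.mem_range_self i)) _

/-- If forms of degree `n` vanishing at `t` have coefficients in `(t)`, then so do the forms of
degree `n` whose value at `t` has order `n + 1`. -/
lemma coeff_mem_of_eval_mem_pow (t : ι → R) {n : ℕ}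
    (h : ∀ G : MvPolynomial ι R, G.IsHomogeneous n → eval t G = 0 →
      ∀ α, G.coeff α ∈ Ideal.span (Set.range t))
    {G : MvPolynomial ι R} (hG : G.IsHomogeneous n)
    (hG' : eval t G ∈ Ideal.span (Set.range t) ^ (n + 1)) (α : ι →₀ ℕ) :
    G.coeff α ∈ Ideal.span (Set.range t) := by
  rw [pow_succ'] at hG'
  obtain ⟨H, h1, h2, h3⟩ := exists_isHomogeneous_of_mem_mul t _ n hG'
  have := h (G - H) (hG.sub h1) (by simp [h3]) α
  rw [coeff_sub] at this
  simpa using Ideal.add_mem _ this (h2 α)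

/-- For a quasi-regular family, an element that is regular modulo `(t)` is regular modulo every
power of `(t)`. -/
lemma mem_pow_of_mul_mem_pow {t : ι → R} (ht : IsQuasiRegular t) {s : R}
    (hs : ∀ a, s * a ∈ Ideal.span (Set.range t) → a ∈ Ideal.span (Set.range t)) (n : ℕ) {a : R}
    (ha : s * a ∈ Ideal.span (Set.range t) ^ n) : a ∈ Ideal.span (Set.range t) ^ n := by
  induction n with
  | zero => simp
  | succ n ih =>
    obtain ⟨A, hA, rfl⟩ := (Ideal.mem_span_pow_iff_exists_isHomogeneous t a).1
      (ih (Ideal.pow_le_pow_right n.le_succ ha))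
    rw [pow_succ']
    refine eval_mem_mul t _ hA fun α ↦ hs _ ?_
    rw [← coeff_C_mul]
    exact coeff_mem_of_eval_mem_pow t (ht n) (hA.C_mul s) (by simpa using ha) α

lemma of_isEmpty [IsEmpty ι] (t : ι → R) : IsQuasiRegular t := by
  intro n G hG h0 α
  rw [eq_C_of_isEmpty G] at h0 ⊢
  rw [eval_C] at h0
  simp [h0]

/-- Adding to a quasi-regular family an element that is regular modulo the ideal it generates gives
a quasi-regular family. A form in the larger family is `G₀ + X * G₁`, with `G₀` not involving the
new variable `X`; regularity modulo powers lets one trade `G₁` for a form in the old variables. -/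
lemma option {t : ι → R} (ht : IsQuasiRegular t) {x : R}
    (hx : ∀ a, x * a ∈ Ideal.span (Set.range t) → a ∈ Ideal.span (Set.range t)) :
    IsQuasiRegular (fun o : Option ι ↦ o.elim x t) := by
  set T : Option ι → R := fun o ↦ o.elim x t with hT
  have hle : Ideal.span (Set.range t) ≤ Ideal.span (Set.range T) :=
    Ideal.span_mono (by rintro _ ⟨i, rfl⟩; exact ⟨some i, rfl⟩)
  have hxT : x ∈ Ideal.span (Set.range T) := Ideal.subset_span ⟨none, rfl⟩
  have hTs : T ∘ some = t := rfl
  intro n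
  induction n with
  | zero =>
    intro G hG h0 α
    rw [← totalDegree_zero_iff_isHomogeneous, totalDegree_eq_zero_iff_eq_C] at hG
    rw [hG] at h0 ⊢
    rw [eval_C] at h0
    simp [h0]
  | succ n ih =>
    intro G hG h0 α
    set G₁ := G.divMonomial (Finsupp.single none 1) with hG₁
    set G₀' := G.modMonomial (Finsupp.single none 1) with hG₀'
    have hdec : X none * G₁ + G₀' = G := divMonomial_add_modMonomial_single G none
    have h1 : G₁.IsHomogeneous n := by
      intro β hβ
      rw [hG₁, coeff_divMonomial] at hβ
      have := hG hβ
      rw [map_add] at this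
      simpa [Finsupp.weight_single, add_comm 1] using this
    have h0h : G₀'.IsHomogeneous (n + 1) := by
      rw [← eq_sub_iff_add_eq'] at hdec
      rw [hdec]
      have := (isHomogeneous_X R (none : Option ι)).mul h1
      rw [add_comm] at this
      exact hG.sub this
    obtain ⟨G₀, hG₀⟩ : ∃ G₀ : MvPolynomial ι R, rename some G₀ = G₀' := by
      refine exists_rename_eq_of_vars_subset_range _ _ (Option.some_injective _) ?_
      intro o ho
      obtain ⟨β, hβ, hoβ⟩ := (mem_vars_iff_mem_support o).1 ho
      cases o with
      | some i => exact ⟨i, rfl⟩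
      | none =>
        exfalso
        refine mem_support_iff.1 hβ (coeff_modMonomial_of_le _ ?_)
        simpa [Finsupp.single_le_iff, Nat.one_le_iff_ne_zero] using hoβ
    have h0h' : G₀.IsHomogeneous (n + 1) := by
      rw [← hG₀] at h0h
      exact (IsHomogeneous.rename_isHomogeneous_iff (Option.some_injective _)).1 h0h
    have hev : x * eval T G₁ + eval t G₀ = 0 := by
      rw [← h0, ← hdec, ← hG₀, map_add, map_mul, eval_X, eval_rename, hTs]
      rfl
    have hmem : eval T G₁ ∈ Ideal.span (Set.range t) ^ (n + 1) := by
      refine ht.mem_pow_of_mul_mem_pow hx _ ?_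
      rw [eq_neg_of_add_eq_zero_left hev]
      exact neg_mem ((Ideal.mem_span_pow_iff_exists_isHomogeneous t _).2 ⟨G₀, h0h', rfl⟩)
    have hc1 := coeff_mem_of_eval_mem_pow T ih h1 (Ideal.pow_right_mono hle _ hmem)
    obtain ⟨H, hH, hHe⟩ := (Ideal.mem_span_pow_iff_exists_isHomogeneous t _).1 hmem
    have hc0 : ∀ β, G₀.coeff β ∈ Ideal.span (Set.range T) := by
      intro β
      have := hle (ht (n + 1) (C x * H + G₀) ((hH.C_mul x).add h0h') (by simp [hHe, hev]) β)
      rw [coeff_add, coeff_C_mul] at this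
      exact (Ideal.add_mem_iff_right _ (Ideal.mul_mem_right _ _ hxT)).1 this
    have key : G ∈ (Ideal.span (Set.range T)).map (C (σ := Option ι)) := by
      rw [← hdec, ← hG₀]
      refine Ideal.add_mem _ (Ideal.mul_mem_left _ _ (mem_map_C_iff.2 hc1)) ?_
      rw [mem_map_C_iff]
      intro β
      by_cases hβ : ∃ γ : ι →₀ ℕ, γ.mapDomain some = β
      · obtain ⟨γ, rfl⟩ := hβ
        rw [coeff_rename_mapDomain _ (Option.some_injective _)]
        exact hc0 γ
      · rw [coeff_rename_eq_zero _ _ _ fun γ hγ ↦ (hβ ⟨γ, hγ⟩).elim]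
        exact zero_mem _
    exact mem_map_C_iff.1 key α

end IsQuasiRegular

/-- An ideal generated by a regular sequence: `I` is built from `0` by successively adding elements
that are regular modulo the ideal already obtained. -/
inductive IsRegularlyGenerated {R : Type*} [CommRing R] : Ideal R → Prop
  | bot : IsRegularlyGenerated ⊥
  | sup_span {I : Ideal R} {x : R} (hI : IsRegularlyGenerated I) (hx : ∀ a, x * a ∈ I → a ∈ I) :
      IsRegularlyGenerated (I ⊔ Ideal.span {x})

namespace IsRegularlyGenerated

variable {R : Type*} [CommRing R]

lemma exists_isQuasiRegular {I : Ideal R} (hI : IsRegularlyGenerated I) :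
    ∃ (ι : Type) (_ : Finite ι) (t : ι → R), Ideal.span (Set.range t) = I ∧ IsQuasiRegular t := by
  induction hI with
  | bot => exact ⟨Empty, inferInstance, Empty.elim, by simp, .of_isEmpty _⟩
  | @sup_span I x _ hx ih =>
    obtain ⟨ι, _, t, rfl, ht⟩ := ih
    refine ⟨Option ι, inferInstance, fun o ↦ o.elim x t, ?_, ht.option hx⟩
    rw [← Ideal.span_union]
    congr 1
    ext y
    simp [Option.exists, eq_comm]

/-- A regular element of `R` followed by a regular sequence of `R ⧸ (x)` is a regular sequence. -/
lemma comap_mk {x : R} (hx : ∀ a, x * a = 0 → a = 0) {J : Ideal (R ⧸ Ideal.span {x})}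
    (hJ : IsRegularlyGenerated J) :
    IsRegularlyGenerated (J.comap (Ideal.Quotient.mk (Ideal.span {x}))) := by
  induction hJ with
  | bot =>
    rw [← RingHom.ker_eq_comap_bot, Ideal.mk_ker, ← bot_sup_eq (Ideal.span {x})]
    exact .sup_span .bot (by simpa using hx)
  | @sup_span J y _ hy ih =>
    obtain ⟨y, rfl⟩ := Ideal.Quotient.mk_surjective y
    have : (J ⊔ Ideal.span {Ideal.Quotient.mk (Ideal.span {x}) y}).comap
        (Ideal.Quotient.mk (Ideal.span {x})) =
        J.comap (Ideal.Quotient.mk (Ideal.span {x})) ⊔ Ideal.span {y} := by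
      have hsurj : Function.Surjective (Ideal.Quotient.mk (Ideal.span {x})) :=
        Ideal.Quotient.mk_surjective
      rw [← Set.image_singleton, ← Ideal.map_span]
      conv_lhs => rw [← Ideal.map_comap_of_surjective _ hsurj J, ← Ideal.map_sup,
        Ideal.comap_map_of_surjective _ hsurj]
      exact sup_eq_left.2 ((Ideal.comap_mono bot_le).trans le_sup_left)
    rw [this]
    refine ih.sup_span fun a ha ↦ hy _ ?_
    simpa using ha

end IsRegularlyGenerated

/-! ### Affine charts of a blowup -/

open MvPolynomial in
/-- Homogenization with respect to the variable `i₀`, characterized by the values of the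
homogenized polynomial. -/
lemma MvPolynomial.exists_homogenization {R : Type u} {ι : Type} [CommRing R] (i₀ : ι)
    (g : MvPolynomial ι R) :
    ∃ (N : ℕ) (G : MvPolynomial ι R), G.IsHomogeneous N ∧
      ∀ {S : Type u} [CommRing S] (f : R →+* S) (v : ι → S) (y : S), v i₀ = 1 →
        eval₂ f (fun i ↦ y * v i) G = y ^ N * eval₂ f v g := by
  classical
  refine ⟨g.totalDegree, ∑ α ∈ g.support,
    monomial (α + Finsupp.single i₀ (g.totalDegree - α.degree)) (g.coeff α), ?_, ?_⟩
  · refine IsHomogeneous.sum _ _ _ fun α hα ↦ isHomogeneous_monomial _ ?_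
    have : α.degree ≤ g.totalDegree := le_totalDegree hα
    simp only [map_add, Finsupp.degree_single]
    omega
  · intro S _ f v y hv
    rw [eval₂_sum, eval₂_eq, Finset.mul_sum]
    refine Finset.sum_congr rfl fun α hα ↦ ?_
    have hle : α.degree ≤ g.totalDegree := le_totalDegree hα
    rw [eval₂_monomial, Finsupp.prod_add_index' (by simp) (by intros; exact pow_add _ _ _),
      Finsupp.prod_single_index (by simp), hv, mul_one]
    simp only [Finsupp.prod, mul_pow, Finset.prod_mul_distrib]
    rw [Finset.prod_pow_eq_pow_sum]
    have : ∑ i ∈ α.support, α i = α.degree := rfl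
    rw [this]
    conv_rhs => rw [← Nat.add_sub_cancel' hle, pow_add]
    ring

open MvPolynomial in
lemma MvPolynomial.eval₂_smul_of_isHomogeneous {R S ι : Type*} [CommRing R] [CommRing S]
    {G : MvPolynomial ι R} {b : ℕ} (hG : G.IsHomogeneous b) (f : R →+* S) (y : S) (v : ι → S) :
    G.eval₂ f (fun i ↦ y * v i) = y ^ b * G.eval₂ f v := by
  rw [eval₂_eq, eval₂_eq, Finset.mul_sum]
  refine Finset.sum_congr rfl fun d hd ↦ ?_
  simp only [mul_pow, Finset.prod_mul_distrib]
  rw [Finset.prod_pow_eq_pow_sum, ← hG.degree_eq_sum_deg_support hd]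
  ring

/-- The order of a nonzero form of degree `b` along a line is at most `b`: if `T ^ n` divides
`S * F (v)`, where the `v i` are polynomials of degree at most `1` in `T`, `S (0) ≠ 0` and
`F (v) ≠ 0`, then `n ≤ b`. -/
lemma MvPolynomial.le_of_X_pow_dvd_mul_eval {L : Type u} {ι : Type} [Field L] {F : MvPolynomial ι L}
    {b n : ℕ} (hF : F.IsHomogeneous b) (v : ι → Polynomial L) (hv : ∀ i, (v i).natDegree ≤ 1)
    {S : Polynomial L} (hS : S.coeff 0 ≠ 0) (hFv : F.eval₂ Polynomial.C v ≠ 0)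
    (h : Polynomial.X ^ n ∣ S * F.eval₂ Polynomial.C v) : n ≤ b := by
  have hX : ¬ Polynomial.X ∣ S := by rwa [Polynomial.X_dvd_iff]
  have h' := Polynomial.prime_X.pow_dvd_of_dvd_mul_left n hX h
  have hdeg := Polynomial.natDegree_le_of_dvd h' hFv
  rw [Polynomial.natDegree_X_pow] at hdeg
  refine hdeg.trans ?_
  rw [eval₂_eq]
  refine Polynomial.natDegree_sum_le_of_forall_le _ _ fun d hd ↦ ?_
  refine (Polynomial.natDegree_C_mul_le _ _).trans ((Polynomial.natDegree_prod_le _ _).trans ?_)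
  rw [hF.degree_eq_sum_deg_support hd]
  refine Finset.sum_le_sum fun i _ ↦ Polynomial.natDegree_pow_le.trans ?_
  simpa using Nat.mul_le_mul_left (d i) (hv i)

namespace BlowupChart

open MvPolynomial

variable {R : Type u} [CommRing R] [IsDomain R] {ι : Type} (t : ι → R) (i₀ : ι)

/-- The ideal of polynomial relations over `R` between the fractions `t i / t i₀`. -/
noncomputable def relations : Ideal (MvPolynomial ι R) :=
  RingHom.ker (eval₂Hom (algebraMap R (FractionRing R))
    fun i ↦ algebraMap R (FractionRing R) (t i) / algebraMap R (FractionRing R) (t i₀))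

instance : (relations t i₀).IsPrime := RingHom.ker_isPrime _

/-- The coordinate ring `R[t / t i₀]` of the chart of the blowup of the ideal `(t)` on which `t i₀`
generates the exceptional ideal. It is presented as a quotient of a polynomial ring. -/
abbrev Chart : Type u := MvPolynomial ι R ⧸ relations t i₀

variable {t i₀}

lemma exists_form_of_mem_relations (h0 : t i₀ ≠ 0) {g : MvPolynomial ι R}
    (hg : g ∈ relations t i₀) :
    ∃ (N : ℕ) (G : MvPolynomial ι R), G.IsHomogeneous N ∧ eval t G = 0 ∧
      ∀ {S : Type u} [CommRing S] (f : R →+* S) (v : ι → S) (y : S), v i₀ = 1 →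
        eval₂ f (fun i ↦ y * v i) G = y ^ N * eval₂ f v g := by
  obtain ⟨N, G, hG, hev⟩ := exists_homogenization i₀ g
  refine ⟨N, G, hG, ?_, hev⟩
  have h0' : algebraMap R (FractionRing R) (t i₀) ≠ 0 := by simpa using h0
  have := hev (algebraMap R (FractionRing R))
    (fun i ↦ algebraMap R (FractionRing R) (t i) / algebraMap R (FractionRing R) (t i₀))
    (algebraMap R (FractionRing R) (t i₀)) (div_self h0')
  rw [show eval₂ (algebraMap R (FractionRing R)) _ g = 0 from RingHom.mem_ker.1 hg,
    mul_zero] at this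
  simp only [mul_div_cancel₀ _ h0'] at this
  rw [← Function.comp_def (algebraMap R (FractionRing R)) t, ← eval₂_comp] at this
  exact IsFractionRing.injective R (FractionRing R) (by rw [this, map_zero])

/-- The chart maps to every `R`-algebra in which `t i₀` is regular and divides all `t i`. -/
lemma eval₂_eq_zero_of_mem_relations (h0 : t i₀ ≠ 0) {O : Type u} [CommRing O] (φ : R →+* O)
    (v : ι → O) (hv : ∀ i, φ (t i) = φ (t i₀) * v i) (hv0 : v i₀ = 1)
    (hreg : φ (t i₀) ∈ nonZeroDivisors O) {g : MvPolynomial ι R} (hg : g ∈ relations t i₀) :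
    eval₂ φ v g = 0 := by
  obtain ⟨N, G, -, hG0, hev⟩ := exists_form_of_mem_relations h0 hg
  have := hev φ v (φ (t i₀)) hv0
  simp only [← hv] at this
  rw [← Function.comp_def φ t, ← eval₂_comp, hG0, map_zero] at this
  exact (mem_nonZeroDivisors_iff.1 (pow_mem hreg N)).1 _ this.symm

/-- If `t` is quasi-regular, then modulo `(t)` the chart is the polynomial ring in the fractions
`t i / t i₀` with `i ≠ i₀`: these may be given arbitrary values in any `R`-algebra killed by
`(t)`. -/
lemma eval₂_eq_zero_of_isQuasiRegular (ht : IsQuasiRegular t) (h0 : t i₀ ≠ 0) {S : Type u}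
    [CommRing S] (f : R →+* S) (v : ι → S) (hv0 : v i₀ = 1) (hf : ∀ i, f (t i) = 0)
    {g : MvPolynomial ι R} (hg : g ∈ relations t i₀) : eval₂ f v g = 0 := by
  obtain ⟨N, G, hG, hG0, hev⟩ := exists_form_of_mem_relations h0 hg
  have := hev f v 1 hv0
  simp only [one_mul, one_pow] at this
  rw [← this, eval₂_eq]
  refine Finset.sum_eq_zero fun α _ ↦ ?_
  have hle : Ideal.span (Set.range t) ≤ RingHom.ker f :=
    Ideal.span_le.2 (by rintro _ ⟨i, rfl⟩; exact hf i)
  rw [show f (G.coeff α) = 0 from hle (ht N G hG hG0 α), zero_mul]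

lemma mk_C_apply (h0 : t i₀ ≠ 0) (i : ι) :
    Ideal.Quotient.mk (relations t i₀) (C (t i)) =
      Ideal.Quotient.mk (relations t i₀) (C (t i₀)) * Ideal.Quotient.mk (relations t i₀) (X i) := by
  rw [← map_mul, Ideal.Quotient.mk_eq_mk_iff_sub_mem]
  have h0' : algebraMap R (FractionRing R) (t i₀) ≠ 0 := by simpa using h0
  simp [relations, RingHom.mem_ker, mul_div_cancel₀ _ h0']

lemma mk_C_ne_zero (h0 : t i₀ ≠ 0) : Ideal.Quotient.mk (relations t i₀) (C (t i₀)) ≠ 0 := by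
  rw [Ne, Ideal.Quotient.eq_zero_iff_mem]
  simpa [relations, RingHom.mem_ker] using h0

lemma mk_C_eval (h0 : t i₀ ≠ 0) {b : ℕ} {G : MvPolynomial ι R} (hG : G.IsHomogeneous b) :
    Ideal.Quotient.mk (relations t i₀) (C (eval t G)) =
      Ideal.Quotient.mk (relations t i₀) (C (t i₀)) ^ b * Ideal.Quotient.mk (relations t i₀) G := by
  rw [← map_pow, ← map_mul, Ideal.Quotient.mk_eq_mk_iff_sub_mem]
  have h0' : algebraMap R (FractionRing R) (t i₀) ≠ 0 := by simpa using h0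
  have := eval₂_smul_of_isHomogeneous hG (algebraMap R (FractionRing R))
    (algebraMap R (FractionRing R) (t i₀))
    (fun i ↦ algebraMap R (FractionRing R) (t i) / algebraMap R (FractionRing R) (t i₀))
  simp only [mul_div_cancel₀ _ h0'] at this
  rw [← Function.comp_def (algebraMap R (FractionRing R)) t, ← eval₂_comp] at this
  simp [relations, RingHom.mem_ker, this]

variable (K : Type u) [Field K] (ū : ι → K) (i₀)

/-- The generic line through the point with coordinates `ū i` of an affine space over `K`. It is
parametrized by `T`, with the value `ū` at `T = 0` and the value `Y i / Y i₀` at `T = 1`, where the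
`Y i` are indeterminates. -/
noncomputable def genericLine (i : ι) : Polynomial (FractionRing (MvPolynomial ι K)) :=
  Polynomial.X *
    Polynomial.C (algebraMap (MvPolynomial ι K) (FractionRing (MvPolynomial ι K)) (X i) /
      algebraMap (MvPolynomial ι K) (FractionRing (MvPolynomial ι K)) (X i₀) -
      algebraMap K (FractionRing (MvPolynomial ι K)) (ū i)) +
    Polynomial.C (algebraMap K (FractionRing (MvPolynomial ι K)) (ū i))

variable {i₀ K ū}

lemma natDegree_genericLine_le (i : ι) : (genericLine i₀ K ū i).natDegree ≤ 1 := by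
  unfold genericLine
  compute_degree

lemma genericLine_self (hu : ū i₀ = 1) : genericLine i₀ K ū i₀ = 1 := by
  simp [genericLine, hu]

lemma coeff_zero_genericLine (i : ι) :
    (genericLine i₀ K ū i).coeff 0 = algebraMap K (FractionRing (MvPolynomial ι K)) (ū i) := by
  simp [genericLine]

/-- A nonzero form `F` does not vanish on the generic line: its value at `T = 1` is
`F (Y) / Y i₀ ^ b`. -/
lemma eval₂_genericLine_ne_zero {F : MvPolynomial ι K} {b : ℕ} (hF : F.IsHomogeneous b)
    (h0 : F ≠ 0) : eval₂ (Polynomial.C.comp (algebraMap K (FractionRing (MvPolynomial ι K))))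
      (genericLine i₀ K ū) F ≠ 0 := by
  intro h
  apply_fun Polynomial.evalRingHom 1 at h
  have hY : algebraMap (MvPolynomial ι K) (FractionRing (MvPolynomial ι K)) (X i₀) ≠ 0 := by
    simp
  rw [eval₂_comp_left, map_zero] at h
  have hg : (Polynomial.evalRingHom (1 : FractionRing (MvPolynomial ι K))) ∘ genericLine i₀ K ū =
      fun i ↦ algebraMap (MvPolynomial ι K) (FractionRing (MvPolynomial ι K)) (X i) /
        algebraMap (MvPolynomial ι K) (FractionRing (MvPolynomial ι K)) (X i₀) := by
    ext i
    simp [genericLine]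
  have hc : (Polynomial.evalRingHom (1 : FractionRing (MvPolynomial ι K))).comp
      (Polynomial.C.comp (algebraMap K (FractionRing (MvPolynomial ι K)))) =
      (algebraMap (MvPolynomial ι K) (FractionRing (MvPolynomial ι K))).comp C := by
    ext a
    simp [IsScalarTower.algebraMap_apply K (MvPolynomial ι K) (FractionRing (MvPolynomial ι K))]
  have := eval₂_smul_of_isHomogeneous hF
    ((algebraMap (MvPolynomial ι K) (FractionRing (MvPolynomial ι K))).comp C)
    (algebraMap (MvPolynomial ι K) (FractionRing (MvPolynomial ι K)) (X i₀))
    (fun i ↦ algebraMap (MvPolynomial ι K) (FractionRing (MvPolynomial ι K)) (X i) /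
        algebraMap (MvPolynomial ι K) (FractionRing (MvPolynomial ι K)) (X i₀))
  simp only [mul_div_cancel₀ _ hY] at this
  rw [← hg, ← hc, h, mul_zero, hc] at this
  rw [← Function.comp_def (algebraMap (MvPolynomial ι K) (FractionRing (MvPolynomial ι K))) X,
    ← eval₂_comp_left, eval₂_eta] at this
  exact h0 (IsFractionRing.injective (MvPolynomial ι K) _ (by rw [this, map_zero]))

/-- The homomorphism from the chart to an `R`-algebra sending `t i / t i₀` to `v i`. -/
noncomputable def lift {S : Type u} [CommRing S] (f : R →+* S) (v : ι → S)
    (h : ∀ g ∈ relations t i₀, eval₂ f v g = 0) : Chart t i₀ →+* S :=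
  Ideal.Quotient.lift _ (eval₂Hom f v) h

lemma lift_mk {S : Type u} [CommRing S] (f : R →+* S) (v : ι → S)
    (h : ∀ g ∈ relations t i₀, eval₂ f v g = 0) (g : MvPolynomial ι R) :
    lift f v h (Ideal.Quotient.mk _ g) = eval₂ f v g := rfl

/-- The order of the strict transform at a point of the chart is at most the degree of the form.
Here the point is the kernel of `χ : Chart t i₀ → K`, the strict transform of `G (t)` is the class
of `G`, and the factor `s` clears denominators in the local ring at the point. The reason is that,
modulo `(t)` and along a generic line through the point, the class of `G` becomes a nonzero
polynomial of degree at most `b`. -/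
lemma le_of_mul_mk_mem_pow (ht : IsQuasiRegular t) (h0 : t i₀ ≠ 0) {K : Type u} [Field K]
    (f : R →+* K) (hf : ∀ i, f (t i) = 0) (χ : Chart t i₀ →+* K)
    (hχ : ∀ a, χ (Ideal.Quotient.mk _ (C a)) = f a)
    (hχ0 : χ (Ideal.Quotient.mk _ (X i₀)) = 1)
    {b n : ℕ} {G : MvPolynomial ι R} (hG : G.IsHomogeneous b) (hGf : map f G ≠ 0)
    {s : Chart t i₀} (hs : χ s ≠ 0) (h : s * Ideal.Quotient.mk _ G ∈ RingHom.ker χ ^ n) :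
    n ≤ b := by
  let L := FractionRing (MvPolynomial ι K)
  let ū : ι → K := fun i ↦ χ (Ideal.Quotient.mk _ (X i))
  let ψ : Chart t i₀ →+* Polynomial L := lift ((Polynomial.C.comp (algebraMap K L)).comp f)
    (genericLine i₀ K ū) fun g hg ↦ eval₂_eq_zero_of_isQuasiRegular ht h0 _ _
      (genericLine_self hχ0) (by simp [hf]) hg
  have hψ : ∀ a, (ψ a).coeff 0 = algebraMap K L (χ a) := by
    intro a
    have : (Polynomial.constantCoeff.comp ψ).comp (Ideal.Quotient.mk (relations t i₀)) =
        ((algebraMap K L).comp χ).comp (Ideal.Quotient.mk (relations t i₀)) := by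
      refine MvPolynomial.ringHom_ext (fun r ↦ ?_) fun i ↦ ?_
      · simp [ψ, lift_mk, hχ]
      · simp [ψ, lift_mk, coeff_zero_genericLine, ū, L]
    obtain ⟨a, rfl⟩ := Ideal.Quotient.mk_surjective a
    exact congr($this a)
  have hker : (RingHom.ker χ).map ψ ≤ Ideal.span {Polynomial.X} := by
    rw [Ideal.map_le_iff_le_comap]
    intro a ha
    rw [Ideal.mem_comap, Ideal.mem_span_singleton, Polynomial.X_dvd_iff, hψ, RingHom.mem_ker.1 ha,
      map_zero]
  have hmem : ψ (s * Ideal.Quotient.mk _ G) ∈ Ideal.span {Polynomial.X ^ n} := by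
    rw [← Ideal.span_singleton_pow]
    refine Ideal.pow_right_mono hker n ?_
    rw [← Ideal.map_pow]
    exact Ideal.mem_map_of_mem _ h
  have hF : ψ (Ideal.Quotient.mk _ G) =
      eval₂ Polynomial.C (genericLine i₀ K ū) (map (algebraMap K L) (map f G)) := by
    rw [eval₂_map, eval₂_map]
    rfl
  rw [map_mul, Ideal.mem_span_singleton, hF] at hmem
  refine le_of_X_pow_dvd_mul_eval ((hG.map f).map _) (genericLine i₀ K ū) natDegree_genericLine_le
    (S := ψ s) ?_ ?_ hmem
  · rw [hψ]
    simpa [L] using hs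
  · rw [eval₂_map]
    exact eval₂_genericLine_ne_zero (hG.map f) hGf

end BlowupChart

open MvPolynomial in
/-- Points of the blowup of a quasi-regular ideal `(t)` of a local domain `R`. Let `R → O` be a
local homomorphism such that the extension of `(t)` to `O` is generated by a regular element. Then
`R → O` factors through a local ring `A` of a chart of the blowup of `(t)`, and the order in
`A` of the strict transform `a` of `G (t)`, where `G` is a form of degree `b` that is nonzero over
the residue field, is at most `b`. -/
theorem exists_localRing_of_isQuasiRegular {R O : Type u} [CommRing R] [IsDomain R] [IsLocalRing R]
    [CommRing O] [IsLocalRing O] (φ : R →+* O) [IsLocalHom φ] {ι : Type} (t : ι → R)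
    (ht : IsQuasiRegular t) (htm : Ideal.span (Set.range t) ≤ IsLocalRing.maximalIdeal R)
    {h : O} (hh : h ∈ nonZeroDivisors O)
    (hI : (Ideal.span (Set.range t)).map φ = Ideal.span {h}) :
    ∃ (A : Type u) (_ : CommRing A) (_ : IsLocalRing A) (α : R →+* A) (β : A →+* O) (x : A),
      IsLocalHom β ∧ β.comp α = φ ∧ x ∈ nonZeroDivisors A ∧
      (Ideal.span (Set.range t)).map α = Ideal.span {x} ∧
      ∀ (b n : ℕ) (G : MvPolynomial ι R) (a : A), G.IsHomogeneous b →
        (∃ γ, G.coeff γ ∉ IsLocalRing.maximalIdeal R) → α (eval t G) = x ^ b * a →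
        a ∈ IsLocalRing.maximalIdeal A ^ n → n ≤ b := by
  -- one of the `t i` generates the extended ideal
  have hdvd : ∀ i, ∃ c, φ (t i) = h * c := fun i ↦ by
    have : φ (t i) ∈ Ideal.span {h} := hI ▸ Ideal.mem_map_of_mem _ (Ideal.subset_span ⟨i, rfl⟩)
    exact Ideal.mem_span_singleton.1 this
  choose c hc using hdvd
  obtain ⟨i₀, hi₀⟩ : ∃ i₀, IsUnit (c i₀) := by
    by_contra! hcon
    have hle : (Ideal.span (Set.range t)).map φ ≤
        Ideal.span {h} * IsLocalRing.maximalIdeal O := by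
      rw [Ideal.map_span, Ideal.span_le]
      rintro _ ⟨_, ⟨i, rfl⟩, rfl⟩
      rw [hc]
      exact Ideal.mul_mem_mul (Ideal.mem_span_singleton_self h) (hcon i)
    rw [hI] at hle
    obtain ⟨d, hd, hhd⟩ :=
      Ideal.mem_span_singleton_mul.1 (hle (Ideal.mem_span_singleton_self h))
    have h1 : h * (d - 1) = 0 := by rw [mul_sub, hhd, mul_one, sub_self]
    have h2 : d = 1 := sub_eq_zero.1 ((mem_nonZeroDivisors_iff.1 hh).1 _ h1)
    exact (IsLocalRing.mem_maximalIdeal d).1 hd (h2 ▸ isUnit_one)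
  obtain ⟨e, he⟩ := hi₀
  have hreg : φ (t i₀) ∈ nonZeroDivisors O := by
    rw [hc, ← he]
    exact mul_mem hh e.isUnit.mem_nonZeroDivisors
  have h0 : t i₀ ≠ 0 := by
    rintro h0
    rw [h0, map_zero] at hreg
    exact zero_notMem_nonZeroDivisors hreg
  let u : ι → O := fun i ↦ ↑e⁻¹ * c i
  have hu0 : u i₀ = 1 := by simp [u, ← he]
  have hu : ∀ i, φ (t i) = φ (t i₀) * u i := by
    intro i
    rw [hc i, hc i₀, ← he]
    simp only [u]
    rw [mul_assoc, ← mul_assoc (e : O), Units.mul_inv, one_mul]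
  let β₀ : BlowupChart.Chart t i₀ →+* O := BlowupChart.lift φ u fun g hg ↦
    BlowupChart.eval₂_eq_zero_of_mem_relations h0 φ u hu hu0 hreg hg
  let q : Ideal (BlowupChart.Chart t i₀) := (IsLocalRing.maximalIdeal O).comap β₀
  have hq : q.IsPrime := inferInstance
  have hqc : ∀ y, y ∈ q.primeCompl ↔ IsUnit (β₀ y) := fun y ↦ by
    rw [Ideal.mem_primeCompl_iff, Ideal.mem_comap, IsLocalRing.notMem_maximalIdeal]
  let A := Localization.AtPrime q
  let j : BlowupChart.Chart t i₀ →+* A := algebraMap _ _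
  have hj : Function.Injective j :=
    IsLocalization.injective A (Ideal.primeCompl_le_nonZeroDivisors q)
  let β : A →+* O := IsLocalization.lift (M := q.primeCompl) (g := β₀) fun y ↦
    (hqc _).1 y.2
  have hβ : ∀ y, β (j y) = β₀ y := fun y ↦ IsLocalization.lift_eq _ y
  let α : R →+* A := (j.comp (Ideal.Quotient.mk _)).comp C
  have hα : ∀ r, α r = j (Ideal.Quotient.mk _ (C r)) := fun _ ↦ rfl
  have hx : α (t i₀) ≠ 0 := by
    rw [hα, Ne, map_eq_zero_iff j hj]
    exact BlowupChart.mk_C_ne_zero h0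
  refine ⟨A, inferInstance, inferInstance, α, β, α (t i₀), ⟨fun y hy ↦ ?_⟩, ?_,
    mem_nonZeroDivisors_of_ne_zero hx, ?_, ?_⟩
  · obtain ⟨⟨a, s⟩, has⟩ := IsLocalization.surj q.primeCompl y
    have ha : IsUnit (β₀ a) := by
      rw [← hβ, show j a = _ from has.symm, map_mul]
      refine hy.mul ?_
      change IsUnit (β (j s))
      rw [hβ]
      exact (hqc _).1 s.2
    have ha' : IsUnit (j a) := IsLocalization.map_units A (⟨a, (hqc a).2 ha⟩ : q.primeCompl)
    rw [show j a = _ from has.symm] at ha'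
    exact isUnit_of_mul_isUnit_left ha'
  · ext r
    simp [hα, hβ, β₀, BlowupChart.lift_mk]
  · refine le_antisymm ?_ ?_
    · rw [Ideal.map_span, Ideal.span_le]
      rintro _ ⟨_, ⟨i, rfl⟩, rfl⟩
      rw [hα (t i), BlowupChart.mk_C_apply h0, map_mul, ← hα]
      exact Ideal.mul_mem_right _ _ (Ideal.mem_span_singleton_self _)
    · rw [Ideal.span_singleton_le_iff_mem]
      exact Ideal.mem_map_of_mem _ (Ideal.subset_span ⟨i₀, rfl⟩)
  · intro b n G a hG hγ hGa ha
    have hGj : a = j (Ideal.Quotient.mk _ G) := by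
      rw [hα, BlowupChart.mk_C_eval h0 hG, map_mul, map_pow, ← hα] at hGa
      exact (mul_left_cancel₀ (pow_ne_zero b hx) hGa).symm
    have hmax : IsLocalRing.maximalIdeal A = q.map j :=
      (Localization.AtPrime.map_eq_maximalIdeal).symm
    rw [hmax, ← Ideal.map_pow, hGj,
      IsLocalization.algebraMap_mem_map_algebraMap_iff q.primeCompl] at ha
    obtain ⟨s, hs, hsG⟩ := ha
    let K := IsLocalRing.ResidueField O
    let χ : BlowupChart.Chart t i₀ →+* K := (IsLocalRing.residue O).comp β₀
    have hχq : RingHom.ker χ = q := by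
      rw [← RingHom.comap_ker, IsLocalRing.ker_residue]
    refine BlowupChart.le_of_mul_mk_mem_pow ht h0 ((IsLocalRing.residue O).comp φ) (fun i ↦ ?_) χ
      (fun r ↦ ?_) ?_ hG (fun hG0 ↦ ?_) (s := s) (fun hs' ↦ ?_) (hχq ▸ hsG)
    · rw [RingHom.comp_apply, IsLocalRing.residue_eq_zero_iff]
      exact map_nonunit φ _ (htm (Ideal.subset_span ⟨i, rfl⟩))
    · simp [χ, β₀, BlowupChart.lift_mk]
    · simp [χ, β₀, BlowupChart.lift_mk, hu0]
    · obtain ⟨γ, hγ⟩ := hγ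
      have := congr(coeff γ $hG0)
      rw [coeff_map, coeff_zero, RingHom.comp_apply, IsLocalRing.residue_eq_zero_iff] at this
      exact hγ (by simpa using this)
    · rw [← RingHom.mem_ker, hχq] at hs'
      exact hs hs'

/-! ### Regular local rings and their regular quotients -/

namespace IsRegularLocalRing

open IsLocalRing

variable {R : Type u} [CommRing R]

/-- Killing an element of `𝔪` outside `𝔪 ^ 2` lowers the embedding dimension. -/
lemma spanFinrank_quotient_succ_le [IsLocalRing R] [IsNoetherianRing R] {x : R}
    (hx : x ∈ maximalIdeal R) (hx2 : x ∉ maximalIdeal R ^ 2)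
    [IsLocalRing (R ⧸ Ideal.span {x})] :
    (maximalIdeal (R ⧸ Ideal.span {x})).spanFinrank + 1 ≤ (maximalIdeal R).spanFinrank := by
  classical
  have hv : (maximalIdeal R).toCotangent ⟨x, hx⟩ ≠ 0 := by
    rwa [Ne, Ideal.toCotangent_eq_zero]
  have hli : LinearIndepOn (ResidueField R) id {(maximalIdeal R).toCotangent ⟨x, hx⟩} :=
    LinearIndepOn.singleton (v := id) hv
  let B := Module.Basis.extend hli
  let W := hli.extend (Set.subset_univ _)
  have hvW : (maximalIdeal R).toCotangent ⟨x, hx⟩ ∈ W := hli.subset_extend _ rfl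
  have hWspan : Submodule.span (ResidueField R) W = ⊤ := by
    simpa [B, W] using B.span_eq
  have hWfin : W.Finite := Module.Finite.finite_basis B
  have hWcard : W.ncard = (maximalIdeal R).spanFinrank := by
    rw [spanFinrank_maximalIdeal_eq_finrank_cotangentSpace, Module.finrank_eq_nat_card_basis B]
    rfl
  let g := Function.surjInv (maximalIdeal R).toCotangent_surjective
  have hg : ∀ w, (maximalIdeal R).toCotangent (g w) = w := Function.surjInv_eq _
  let S : Set (maximalIdeal R) := g '' (W \ {(maximalIdeal R).toCotangent ⟨x, hx⟩})
  have hspan : Submodule.span R (insert ⟨x, hx⟩ S) = ⊤ := by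
    rw [← CotangentSpace.span_image_eq_top_iff, ← hWspan]
    congr 1
    rw [Set.image_insert_eq, Set.image_image]
    simp only [hg, Set.image_id']
    rw [Set.insert_sdiff_singleton, Set.insert_eq_of_mem hvW]
  have hspan' : Ideal.span (insert x (Subtype.val '' S)) = maximalIdeal R := by
    have := congr(Submodule.map (maximalIdeal R).subtype $hspan)
    rw [Submodule.map_span, Submodule.map_top, Submodule.range_subtype, Set.image_insert_eq] at this
    exact this
  have hmk : Function.Surjective (Ideal.Quotient.mk (Ideal.span {x})) :=
    Ideal.Quotient.mk_surjective
  have hloc : IsLocalHom (Ideal.Quotient.mk (Ideal.span {x})) := IsLocalHom.of_surjective _ hmk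
  have hmax : maximalIdeal (R ⧸ Ideal.span {x}) =
      Ideal.span (Ideal.Quotient.mk (Ideal.span {x}) '' (Subtype.val '' S)) := by
    have h1 : maximalIdeal (R ⧸ Ideal.span {x}) =
        (maximalIdeal R).map (Ideal.Quotient.mk (Ideal.span {x})) := by
      rw [← maximalIdeal_comap (Ideal.Quotient.mk (Ideal.span {x})),
        Ideal.map_comap_of_surjective _ hmk]
    refine h1.trans ((congrArg (Ideal.map _) hspan'.symm).trans ?_)
    rw [Ideal.map_span, Set.image_insert_eq,
      Ideal.Quotient.eq_zero_iff_mem.2 (Ideal.mem_span_singleton_self x)]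
    exact Submodule.span_insert_zero
  have hSfin : S.Finite := (hWfin.sdiff).image _
  have hScard : S.ncard + 1 ≤ W.ncard := by
    have : S.ncard ≤ _ := Set.ncard_image_le (f := g)
      (hWfin.sdiff (t := {(maximalIdeal R).toCotangent ⟨x, hx⟩}))
    have h2 := Set.ncard_sdiff_singleton_add_one hvW hWfin
    omega
  rw [← hWcard, hmax]
  refine le_trans (Nat.add_le_add_right ?_ 1) hScard
  refine (Submodule.spanFinrank_span_le_ncard_of_finite ((hSfin.image _).image _)).trans ?_
  exact (Set.ncard_image_le (hSfin.image _)).trans (Set.ncard_image_le hSfin)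

lemma isLocalRing_quotient [IsLocalRing R] {I : Ideal R} (hI : I ≤ maximalIdeal R) :
    IsLocalRing (R ⧸ I) := by
  have : Nontrivial (R ⧸ I) := Ideal.Quotient.nontrivial_iff.2
    fun h ↦ (maximalIdeal.isMaximal R).ne_top (top_le_iff.1 (h ▸ hI))
  exact IsLocalRing.of_surjective' (Ideal.Quotient.mk I) Ideal.Quotient.mk_surjective

/-- The quotient of a regular local ring by an element of `𝔪` outside `𝔪 ^ 2` is regular. -/
theorem quotient_span_singleton [IsRegularLocalRing R] {x : R}
    (hx : x ∈ maximalIdeal R) (hx2 : x ∉ maximalIdeal R ^ 2) :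
    IsRegularLocalRing (R ⧸ Ideal.span {x}) := by
  have hle : Ideal.span {x} ≤ maximalIdeal R := (Ideal.span_singleton_le_iff_mem _).2 hx
  have := isLocalRing_quotient hle
  refine .of_spanFinrank_maximalIdeal_le _ ?_
  have h1 := spanFinrank_quotient_succ_le hx hx2
  have h2 := ringKrullDim_le_ringKrullDim_quotient_add_spanFinrank (Ideal.span {x})
    (hle.trans (IsLocalRing.ringJacobson_eq_maximalIdeal R).ge)
  have h3 : (Ideal.span {x}).spanFinrank ≤ 1 :=
    (Submodule.spanFinrank_span_le_ncard_of_finite (Set.finite_singleton x)).trans (by simp)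
  rw [← spanFinrank_maximalIdeal (R := R)] at h2
  have h4 : (((maximalIdeal (R ⧸ Ideal.span {x})).spanFinrank + 1 : ℕ) : WithBot ℕ∞) ≤
      ringKrullDim (R ⧸ Ideal.span {x}) + 1 := by
    refine le_trans (by exact_mod_cast h1) (h2.trans ?_)
    gcongr
    exact_mod_cast h3
  rw [Nat.cast_add, Nat.cast_one] at h4
  exact ENat.WithBot.add_le_add_one_right_iff.1 h4

/-- A regular local ring is a domain. By induction on the dimension: if `x ∈ 𝔪` lies outside
`𝔪 ^ 2` and the minimal primes, then `(x)` is prime, and a minimal prime `P ≤ (x)` satisfies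
`P = x P`, so that it vanishes. -/
theorem isDomain [IsRegularLocalRing R] : IsDomain R := by
  obtain ⟨d, hd⟩ : ∃ d, (maximalIdeal R).spanFinrank = d := ⟨_, rfl⟩
  induction d using Nat.strong_induction_on generalizing R with
  | _ d ih =>
    by_cases hm : maximalIdeal R = ⊥
    · have : (⊥ : Ideal R).IsPrime := hm ▸ inferInstance
      exact IsDomain.of_bot_isPrime R
    have hfg := (maximalIdeal R).fg_of_isNoetherianRing
    have hm2 : ¬ maximalIdeal R ≤ maximalIdeal R ^ 2 := fun h ↦ hm <|
      Submodule.eq_bot_of_le_smul_of_le_jacobson_bot (maximalIdeal R) _ hfg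
        (by rwa [smul_eq_mul, ← sq]) (jacobson_eq_maximalIdeal ⊥ bot_ne_top).ge
    have hmin : maximalIdeal R ∉ minimalPrimes R := fun h ↦ by
      have h0 : ringKrullDim R = 0 := by
        rw [← maximalIdeal_height_eq_ringKrullDim, Ideal.height_eq_zero_iff.2 h]
        rfl
      rw [← spanFinrank_maximalIdeal (R := R)] at h0
      exact hm ((Submodule.spanFinrank_eq_zero_iff_eq_bot hfg).1 (by exact_mod_cast h0))
    obtain ⟨x, hx, hxn⟩ : ∃ x ∈ maximalIdeal R, x ∉ ⋃ P ∈ insert (maximalIdeal R ^ 2)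
        (minimalPrimes R), (P : Set R) := by
      by_contra! hcon
      obtain ⟨P, hP, hle⟩ := (Ideal.subset_union_prime_finite
        ((minimalPrimes.finite_of_isNoetherianRing R).insert (maximalIdeal R ^ 2)) (f := id)
        (maximalIdeal R ^ 2) (maximalIdeal R ^ 2) (fun P hP h _ ↦
          ((Set.mem_insert_iff.1 hP).resolve_left h).1.1)).1 hcon
      rcases Set.mem_insert_iff.1 hP with rfl | hP
      · exact hm2 hle
      · have : P.IsPrime := hP.1.1
        have heq : maximalIdeal R = P := le_antisymm hle (le_maximalIdeal this.ne_top)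
        exact hmin (heq ▸ hP)
    simp only [Set.mem_insert_iff, Set.iUnion_iUnion_eq_or_left, Set.mem_union, SetLike.mem_coe,
      Set.mem_iUnion, not_or, not_exists] at hxn
    have := quotient_span_singleton hx hxn.1
    have hlt := spanFinrank_quotient_succ_le hx hxn.1
    have hdom : IsDomain (R ⧸ Ideal.span {x}) := ih _ (by omega) rfl
    have hprime : (Ideal.span {x}).IsPrime := (Ideal.Quotient.isDomain_iff_prime _).1 hdom
    obtain ⟨P, hP, hPx⟩ := Ideal.exists_minimalPrimes_le (bot_le (a := Ideal.span {x}))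
    have hPp : P.IsPrime := hP.1.1
    have hP0 : P = ⊥ := by
      refine Submodule.eq_bot_of_le_smul_of_le_jacobson_bot (maximalIdeal R) P
        P.fg_of_isNoetherianRing (fun y hy ↦ ?_) (jacobson_eq_maximalIdeal ⊥ bot_ne_top).ge
      obtain ⟨c, rfl⟩ := Ideal.mem_span_singleton.1 (hPx hy)
      exact Ideal.mul_mem_mul hx ((hPp.mem_or_mem hy).resolve_left (hxn.2 P hP))
    have : (⊥ : Ideal R).IsPrime := hP0 ▸ hPp
    exact IsDomain.of_bot_isPrime R

/-- An ideal contained in `𝔪 ^ 2` does not change the embedding dimension. -/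
lemma spanFinrank_le_of_le_sq [IsLocalRing R] [IsNoetherianRing R] {I : Ideal R}
    (hI : I ≤ maximalIdeal R ^ 2) [IsLocalRing (R ⧸ I)] :
    (maximalIdeal R).spanFinrank ≤ (maximalIdeal (R ⧸ I)).spanFinrank := by
  have hmk : Function.Surjective (Ideal.Quotient.mk I) := Ideal.Quotient.mk_surjective
  have hloc : IsLocalHom (Ideal.Quotient.mk I) := IsLocalHom.of_surjective _ hmk
  have hcomap : (maximalIdeal (R ⧸ I)).comap (Ideal.Quotient.mk I) = maximalIdeal R :=
    maximalIdeal_comap _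
  have hfg := (maximalIdeal (R ⧸ I)).fg_of_isNoetherianRing
  obtain ⟨s, hs, hspan⟩ := Submodule.FG.exists_span_finset_card_eq_spanFinrank hfg
  classical
  let g := Function.surjInv hmk
  have hg : ∀ y, Ideal.Quotient.mk I (g y) = y := Function.surjInv_eq _
  have hle : Ideal.span (g '' s) ≤ maximalIdeal R := by
    rw [Ideal.span_le]
    rintro _ ⟨y, hy, rfl⟩
    rw [SetLike.mem_coe, ← hcomap, Ideal.mem_comap, hg, ← hspan]
    exact Submodule.subset_span hy
  have hge : maximalIdeal R ≤ Ideal.span (g '' s) := by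
    refine Submodule.le_of_le_smul_of_le_jacobson_bot (I := maximalIdeal R)
      (maximalIdeal R).fg_of_isNoetherianRing (jacobson_eq_maximalIdeal ⊥ bot_ne_top).ge ?_
    rw [smul_eq_mul, ← sq]
    refine le_trans ?_ (sup_le_sup_left hI _)
    have : (Ideal.span (g '' s)).map (Ideal.Quotient.mk I) = maximalIdeal (R ⧸ I) := by
      rw [Ideal.map_span, Set.image_image]
      simp only [hg, Set.image_id']
      exact hspan
    rw [← hcomap, ← this, Ideal.comap_map_of_surjective _ hmk, ← RingHom.ker_eq_comap_bot,
      Ideal.mk_ker]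
  rw [le_antisymm hge hle, ← hs, ← Set.ncard_coe_finset]
  exact (Submodule.spanFinrank_span_le_ncard_of_finite (s.finite_toSet.image g)).trans
    (Set.ncard_image_le s.finite_toSet)

/-- If `R` and `R ⧸ I` are regular local rings, then `I` is generated by a regular sequence. -/
theorem isRegularlyGenerated [IsRegularLocalRing R] (I : Ideal R)
    [hI : IsRegularLocalRing (R ⧸ I)] :
    IsRegularlyGenerated I := by
  obtain ⟨d, hd⟩ : ∃ d, (maximalIdeal R).spanFinrank = d := ⟨_, rfl⟩
  induction d using Nat.strong_induction_on generalizing R with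
  | _ d ih =>
    have hdom := isDomain (R := R)
    have hIm : I ≤ maximalIdeal R := le_maximalIdeal
      (Ideal.Quotient.nontrivial_iff.1 (inferInstance : Nontrivial (R ⧸ I)))
    by_cases hI0 : I = ⊥
    · exact hI0 ▸ .bot
    obtain ⟨x, hxI, hx2⟩ : ∃ x ∈ I, x ∉ maximalIdeal R ^ 2 := by
      by_contra! hcon
      obtain ⟨y, hy, hy0⟩ := Submodule.exists_mem_ne_zero_of_ne_bot hI0
      have h1 := ringKrullDim_succ_le_of_surjective (Ideal.Quotient.mk I)
        Ideal.Quotient.mk_surjective (mem_nonZeroDivisors_of_ne_zero hy0)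
        (Ideal.Quotient.eq_zero_iff_mem.2 hy)
      rw [← spanFinrank_maximalIdeal (R := R), ← spanFinrank_maximalIdeal (R := R ⧸ I)] at h1
      have h2 := spanFinrank_le_of_le_sq (I := I) hcon
      have h3 : (maximalIdeal (R ⧸ I)).spanFinrank + 1 ≤ (maximalIdeal R).spanFinrank := by
        exact_mod_cast h1
      omega
    have hxm := hIm hxI
    have hx0 : x ≠ 0 := fun h ↦ hx2 (h ▸ zero_mem _)
    have hle : Ideal.span {x} ≤ I := (Ideal.span_singleton_le_iff_mem _).2 hxI
    have := quotient_span_singleton hxm hx2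
    have hlt := spanFinrank_quotient_succ_le hxm hx2
    have : IsRegularLocalRing
        ((R ⧸ Ideal.span {x}) ⧸ I.map (Ideal.Quotient.mk (Ideal.span {x}))) :=
      .of_ringEquiv (DoubleQuot.quotQuotEquivQuotOfLE hle).symm
    have := (ih _ (by omega) (I.map (Ideal.Quotient.mk (Ideal.span {x}))) rfl).comap_mk
      (fun a ha ↦ (mul_eq_zero.1 ha).resolve_left hx0)
    rwa [Ideal.comap_map_of_surjective _ Ideal.Quotient.mk_surjective, ← RingHom.ker_eq_comap_bot,
      Ideal.mk_ker, sup_eq_left.2 hle] at this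

end IsRegularLocalRing

/-! ### Stalks and pullbacks of ideal sheaves -/

namespace AlgebraicGeometry.Scheme.IdealSheafData

variable {X Y : Scheme.{u}}

lemma map_germ_le_of_mem (J : X.IdealSheafData) {U W : X.affineOpens} {x : X} (hU : x ∈ U.1)
    (hW : x ∈ W.1) :
    (J.ideal W).map (X.presheaf.germ W.1 x hW).hom ≤
      (J.ideal U).map (X.presheaf.germ U.1 x hU).hom := by
  obtain ⟨f, g, hfg, hxf⟩ := exists_basicOpen_le_affine_inter U.2 W.2 x ⟨hU, hW⟩
  replace hxf : x ∈ (X.affineBasicOpen f).1 := hxf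
  have hf : (X.affineBasicOpen f).1 ≤ U.1 := X.basicOpen_le f
  have hg : (X.affineBasicOpen f).1 ≤ W.1 := hfg.trans_le (X.basicOpen_le g)
  have h3 := (J.map_ideal' (homOfLE hg).op).trans (J.map_ideal' (homOfLE hf).op).symm
  apply_fun Ideal.map (X.presheaf.germ (X.affineBasicOpen f).1 x hxf).hom at h3
  rw [Ideal.map_map, Ideal.map_map, ← CommRingCat.hom_comp, ← CommRingCat.hom_comp,
    X.presheaf.germ_res, X.presheaf.germ_res] at h3
  exact h3.le

/-- The stalk of an ideal sheaf may be computed on any affine open neighbourhood. -/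
lemma stalkIdeal_eq (J : X.IdealSheafData) {U : X.affineOpens} {x : X} (hU : x ∈ U.1) :
    J.stalkIdeal x = (J.ideal U).map (X.presheaf.germ U.1 x hU).hom :=
  le_antisymm (iSup₂_le fun _ hW ↦ J.map_germ_le_of_mem hU hW)
    (le_iSup₂_of_le U hU le_rfl)

lemma exists_affineOpens_mem (x : X) : ∃ U : X.affineOpens, x ∈ U.1 := by
  obtain ⟨U, hU, hx, -⟩ := X.isBasis_affineOpens.exists_subset_of_mem_open
    (Set.mem_univ x) isOpen_univ
  obtain ⟨U, hU, rfl⟩ := hU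
  exact ⟨⟨U, hU⟩, hx⟩

lemma le_iff_stalkIdeal_le {I J : X.IdealSheafData} :
    I ≤ J ↔ ∀ x, I.stalkIdeal x ≤ J.stalkIdeal x := by
  refine ⟨fun h x ↦ ?_, fun h U ↦ U.2.ideal_le_iff.2 fun x hx ↦ ?_⟩
  · obtain ⟨U, hU⟩ := exists_affineOpens_mem x
    rw [stalkIdeal_eq _ hU, stalkIdeal_eq _ hU]
    exact Ideal.map_mono (h U)
  · rw [← stalkIdeal_eq _ hx, ← stalkIdeal_eq _ hx]
    exact h x

lemma ext_stalkIdeal {I J : X.IdealSheafData} (h : ∀ x, I.stalkIdeal x = J.stalkIdeal x) : I = J :=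
  le_antisymm (le_iff_stalkIdeal_le.2 fun x ↦ (h x).le) (le_iff_stalkIdeal_le.2 fun x ↦ (h x).ge)

lemma stalkIdeal_mul (I J : X.IdealSheafData) (x : X) :
    (I * J).stalkIdeal x = I.stalkIdeal x * J.stalkIdeal x := by
  obtain ⟨U, hU⟩ := exists_affineOpens_mem x
  rw [stalkIdeal_eq _ hU, stalkIdeal_eq _ hU, stalkIdeal_eq _ hU, ← Ideal.map_mul]
  rfl

lemma stalkIdeal_pow (I : X.IdealSheafData) (n : ℕ) (x : X) :
    (I ^ n).stalkIdeal x = I.stalkIdeal x ^ n := by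
  obtain ⟨U, hU⟩ := exists_affineOpens_mem x
  rw [stalkIdeal_eq _ hU, stalkIdeal_eq _ hU, ← Ideal.map_pow]
  rfl

lemma mem_support_iff_stalkIdeal_le (I : X.IdealSheafData) (x : X) :
    x ∈ I.support ↔ I.stalkIdeal x ≤ IsLocalRing.maximalIdeal (X.presheaf.stalk x) := by
  obtain ⟨U, hU⟩ := exists_affineOpens_mem x
  rw [mem_support_iff_of_mem hU, stalkIdeal_eq _ hU, Ideal.map_le_iff_le_comap,
    Scheme.mem_zeroLocus_iff]
  refine forall₂_congr fun s hs ↦ ?_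
  rw [Ideal.mem_comap, IsLocalRing.mem_maximalIdeal, mem_nonunits_iff, not_iff_not]
  exact X.mem_basicOpen s x hU

lemma ideal_comap_of_isAffine [IsAffine X] [IsAffine Y] (I : Y.IdealSheafData) (f : X ⟶ Y) :
    (I.comap f).ideal ⟨⊤, isAffineOpen_top X⟩ =
      (I.ideal ⟨⊤, isAffineOpen_top Y⟩).map f.appTop.hom := by
  have key : ∀ K : X.IdealSheafData, I.comap f ≤ K ↔
      (I.ideal ⟨⊤, isAffineOpen_top Y⟩).map f.appTop.hom ≤ K.ideal ⟨⊤, isAffineOpen_top X⟩ := by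
    intro K
    rw [← le_map_iff_comap_le, Ideal.map_le_iff_le_comap]
    have := ideal_map_of_isAffineHom K f ⟨⊤, isAffineOpen_top Y⟩
    constructor
    · intro h
      exact (h ⟨⊤, isAffineOpen_top Y⟩).trans this.le
    · intro h
      exact le_of_isAffine (h.trans this.ge)
  refine le_antisymm ?_ ((key _).1 le_rfl)
  have := (key (ofIdealTop ((I.ideal ⟨⊤, isAffineOpen_top Y⟩).map f.appTop.hom))).2 (by simp)
  simpa using this ⟨⊤, isAffineOpen_top X⟩

lemma ideal_comap_of_isOpenImmersion_of_le (I : Y.IdealSheafData) (j : X ⟶ Y) [IsOpenImmersion j]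
    (U : X.affineOpens) (W : Y.affineOpens) (h : U.1 ≤ j ⁻¹ᵁ W.1) :
    (I.comap j).ideal U = (I.ideal W).map (j.appLE W.1 U.1 h).hom := by
  have hle : j ''ᵁ U.1 ≤ W.1 := by
    rintro _ ⟨x, hx, rfl⟩
    exact h hx
  have h1 := I.map_ideal' (U := ⟨j ''ᵁ U, U.2.image_of_isOpenImmersion j⟩) (V := W)
    (homOfLE hle).op
  have h2 : ∀ K : Ideal Γ(Y, j ''ᵁ U.1), K.comap (j.appIso U.1).inv.hom =
      K.map (j.appIso U.1).hom.hom := fun K ↦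
    Ideal.comap_symm (j.appIso U.1).commRingCatIsoToRingEquiv
  rw [ideal_comap_of_isOpenImmersion, ← h1, h2, Ideal.map_map, ← CommRingCat.hom_comp,
    Scheme.Hom.appIso_hom', Scheme.Hom.map_appLE]

lemma ideal_comap (I : Y.IdealSheafData) (f : X ⟶ Y) (U : Y.affineOpens) (W : X.affineOpens)
    (h : W.1 ≤ f ⁻¹ᵁ U.1) :
    (I.comap f).ideal W = (I.ideal U).map (f.appLE U.1 W.1 h).hom := by
  have : IsAffine W.1.toScheme := W.2
  have : IsAffine U.1.toScheme := U.2
  have h1 := ideal_comap_of_isOpenImmersion_of_le (I.comap f) W.1.ι ⟨⊤, isAffineOpen_top _⟩ W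
    (by simp)
  have h2 := ideal_comap_of_isOpenImmersion_of_le I U.1.ι ⟨⊤, isAffineOpen_top _⟩ U
    (by simp)
  have h3 := ideal_comap_of_isAffine (I.comap U.1.ι) (f.resLE U.1 W.1 h)
  rw [← comap_comp, Scheme.Hom.resLE_comp_ι, comap_comp, h1, h2, Ideal.map_map,
    ← CommRingCat.hom_comp] at h3
  have h4 : U.1.ι.appLE U.1 ⊤ (by simp) ≫ (f.resLE U.1 W.1 h).appTop =
      f.appLE U.1 W.1 h ≫ W.1.ι.appLE W.1 ⊤ (by simp) := by
    have h5 : (f.resLE U.1 W.1 h).appTop = (f.resLE U.1 W.1 h).appLE ⊤ ⊤ (by simp) :=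
      Scheme.Hom.app_eq_appLE _
    refine (congrArg _ h5).trans ((Scheme.Hom.appLE_comp_appLE ..).trans ?_)
    rw [Scheme.Hom.appLE_comp_appLE]
    simp only [Scheme.Hom.resLE_comp_ι]
  rw [h4, CommRingCat.hom_comp, ← Ideal.map_map] at h3
  have h5 : Function.Bijective (W.1.ι.appLE W.1 ⊤ (by simp)).hom := by
    have : IsIso (W.1.ι.appLE W.1 ⊤ (by simp)) := by
      rw [Scheme.Opens.ι_appLE]
      exact (X.presheaf.mapIso (eqToIso W.1.ι_image_top).op).isIso_hom
    exact (asIso (W.1.ι.appLE W.1 ⊤ _)).commRingCatIsoToRingEquiv.bijective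
  rw [← Ideal.comap_map_of_bijective _ h5 (I := (I.comap f).ideal W), h3,
    Ideal.comap_map_of_bijective _ h5]

lemma stalkIdeal_comap (I : Y.IdealSheafData) (f : X ⟶ Y) (x : X) :
    (I.comap f).stalkIdeal x = (I.stalkIdeal (f x)).map (f.stalkMap x).hom := by
  obtain ⟨U, hU⟩ := exists_affineOpens_mem (f x)
  obtain ⟨_, ⟨W, hW, rfl⟩, hxW, hWU⟩ := X.isBasis_affineOpens.exists_subset_of_mem_open
    (show x ∈ f ⁻¹ᵁ U.1 from hU) (f ⁻¹ᵁ U.1).2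
  rw [stalkIdeal_eq _ (U := ⟨W, hW⟩) hxW, stalkIdeal_eq _ hU, ideal_comap I f U ⟨W, hW⟩ hWU,
    Ideal.map_map, Ideal.map_map, ← CommRingCat.hom_comp, ← CommRingCat.hom_comp,
    Scheme.Hom.germ_stalkMap, ← X.presheaf.germ_res (homOfLE hWU) x hxW,
    Scheme.Hom.app_eq_appLE, Scheme.Hom.appLE_map_assoc]

lemma comap_pow (I : Y.IdealSheafData) (f : X ⟶ Y) (n : ℕ) :
    (I ^ n).comap f = I.comap f ^ n :=
  ext_stalkIdeal fun x ↦ by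
    simp only [stalkIdeal_comap, stalkIdeal_pow, Ideal.map_pow]

/-- The pullback of `I` along `Spec A ⟶ Spec 𝒪_{X, x} ⟶ X` is the extension to `A` of the stalk of
`I` at `x`. -/
lemma ideal_comap_fromSpecStalk (I : X.IdealSheafData) (x : X) {A : CommRingCat.{u}}
    (α : X.presheaf.stalk x ⟶ A) :
    (I.comap (Spec.map α ≫ X.fromSpecStalk x)).ideal ⟨⊤, isAffineOpen_top _⟩ =
      (I.stalkIdeal x).map ((α ≫ (Scheme.ΓSpecIso A).inv).hom) := by
  obtain ⟨U, hU⟩ := exists_affineOpens_mem x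
  have h1 : (X.fromSpecStalk x) ⁻¹ᵁ U.1 = ⊤ :=
    preimage_eq_top_of_closedPoint_mem _ (by rwa [fromSpecStalk_closedPoint])
  rw [comap_comp, ideal_comap_of_isAffine, ideal_comap I (X.fromSpecStalk x) U _ (by simp [h1]),
    stalkIdeal_eq _ hU, Ideal.map_map, Ideal.map_map, ← CommRingCat.hom_comp,
    ← CommRingCat.hom_comp]
  congr 2
  have h2 : (X.fromSpecStalk x).appLE U.1 ⊤ (by simp [h1]) =
      X.presheaf.germ U.1 x hU ≫ (ΓSpecIso (X.presheaf.stalk x)).inv := by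
    have : (X.fromSpecStalk x).appLE U.1 ⊤ (by simp [h1]) = (X.fromSpecStalk x).app U.1 ≫
      (Spec (X.presheaf.stalk x)).presheaf.map (homOfLE (by simp [h1])).op := rfl
    rw [this, Scheme.fromSpecStalk_app hU, Category.assoc, Category.assoc, ← Functor.map_comp]
    have h3 : ∀ g : Opposite.op (⊤ : (Spec (X.presheaf.stalk x)).Opens) ⟶ Opposite.op ⊤,
        (Spec (X.presheaf.stalk x)).presheaf.map g = 𝟙 _ := fun g ↦ by
      rw [Subsingleton.elim g (𝟙 _), CategoryTheory.Functor.map_id]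
    exact (congrArg (fun k ↦ X.presheaf.germ U.1 x hU ≫
      (ΓSpecIso (X.presheaf.stalk x)).inv ≫ k) (h3 _)).trans (by rw [Category.comp_id])
  rw [h2, Category.assoc, ΓSpecIso_inv_naturality]

/-- An ideal sheaf on an affine scheme generated by one regular section is invertible. -/
lemma isInvertible_of_isAffine [IsAffine X] {I : X.IdealSheafData} {f : Γ(X, ⊤)}
    (hf : f ∈ nonZeroDivisors Γ(X, ⊤))
    (hI : I.ideal ⟨⊤, isAffineOpen_top X⟩ = Ideal.span {f}) : I.IsInvertible :=
  fun _ ↦ ⟨⟨⊤, isAffineOpen_top X⟩, trivial, f, hf, hI⟩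

lemma isInvertible_comap_fromSpecStalk (I : X.IdealSheafData) (x : X) {A : CommRingCat.{u}}
    (α : X.presheaf.stalk x ⟶ A) {h : A} (hh : h ∈ nonZeroDivisors A)
    (hI : (I.stalkIdeal x).map α.hom = Ideal.span {h}) :
    (I.comap (Spec.map α ≫ X.fromSpecStalk x)).IsInvertible := by
  let e := (Scheme.ΓSpecIso A).symm.commRingCatIsoToRingEquiv
  refine isInvertible_of_isAffine (f := e h)
    (MulEquivClass.map_nonZeroDivisors e ▸ ⟨h, hh, rfl⟩) ?_
  rw [ideal_comap_fromSpecStalk, CommRingCat.hom_comp, ← Ideal.map_map, hI, Ideal.map_span,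
    Set.image_singleton]
  rfl

lemma IsInvertible.exists_stalkIdeal_eq {I : X.IdealSheafData} (hI : I.IsInvertible) (x : X) :
    ∃ h ∈ nonZeroDivisors (X.presheaf.stalk x), I.stalkIdeal x = Ideal.span {h} := by
  obtain ⟨U, hU, f, hf, hIf⟩ := hI x
  refine ⟨X.presheaf.germ U.1 x hU f, ?_, ?_⟩
  · let := X.presheaf.algebra_section_stalk ⟨x, hU⟩
    have := U.2.isLocalization_stalk ⟨x, hU⟩
    exact IsLocalization.map_nonZeroDivisors_le (U.2.primeIdealOf ⟨x, hU⟩).asIdeal.primeCompl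
      (X.presheaf.stalk x) ⟨f, hf, rfl⟩
  · rw [stalkIdeal_eq _ hU, hIf, Ideal.map_span, Set.image_singleton]

end AlgebraicGeometry.Scheme.IdealSheafData

namespace AlgebraicGeometry.Scheme.IdealSheafData

variable {X : Scheme.{u}}

/-! ### Order and local rings of closed subschemes -/

lemma natCast_le_orderAt {J : X.IdealSheafData} {x : X} {n : ℕ}
    (h : J.stalkIdeal x ≤ IsLocalRing.maximalIdeal (X.presheaf.stalk x) ^ n) :
    (n : ℕ∞) ≤ J.orderAt x :=
  le_iSup₂_of_le (f := fun (n : ℕ)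
    (_ : J.stalkIdeal x ≤ IsLocalRing.maximalIdeal (X.presheaf.stalk x) ^ n) ↦ (n : ℕ∞)) n h le_rfl

lemma orderAt_le {J : X.IdealSheafData} {x : X} {c : ℕ∞}
    (h : ∀ n : ℕ, J.stalkIdeal x ≤ IsLocalRing.maximalIdeal (X.presheaf.stalk x) ^ n →
      (n : ℕ∞) ≤ c) :
    J.orderAt x ≤ c :=
  iSup₂_le h

lemma stalkIdeal_le_pow_of_le_orderAt {J : X.IdealSheafData} {x : X} {b : ℕ}
    (h : (b : ℕ∞) ≤ J.orderAt x) :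
    J.stalkIdeal x ≤ IsLocalRing.maximalIdeal (X.presheaf.stalk x) ^ b := by
  cases b with
  | zero => simp
  | succ b =>
    by_contra hcon
    have : J.orderAt x ≤ b := orderAt_le fun n hn ↦ by
      by_contra! hlt
      exact hcon (hn.trans (Ideal.pow_le_pow_right (by exact_mod_cast hlt)))
    have := h.trans this
    norm_cast at this
    omega

lemma ker_stalkMap_subschemeι (I : X.IdealSheafData) (z : I.subscheme) :
    RingHom.ker (I.subschemeι.stalkMap z).hom = I.stalkIdeal (I.subschemeι z) := by
  obtain ⟨U, hU⟩ := exists_affineOpens_mem (I.subschemeι z)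
  have hz : z ∈ I.subschemeι ⁻¹ᵁ U.1 := hU
  have hU' : IsAffineOpen (I.subschemeι ⁻¹ᵁ U.1) := U.2.preimage I.subschemeι
  have hgerm : ∀ s, (I.subschemeι.stalkMap z).hom (X.presheaf.germ U.1 _ hU s) =
      I.subscheme.presheaf.germ (I.subschemeι ⁻¹ᵁ U.1) z hz (I.subschemeι.app U.1 s) :=
    fun s ↦ Scheme.Hom.germ_stalkMap_apply _ _ _ _ _
  rw [stalkIdeal_eq I hU]
  refine le_antisymm (fun a ha ↦ ?_) ?_
  · let := X.presheaf.algebra_section_stalk ⟨I.subschemeι z, hU⟩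
    have := U.2.isLocalization_stalk ⟨I.subschemeι z, hU⟩
    let := I.subscheme.presheaf.algebra_section_stalk ⟨z, hz⟩
    have := hU'.isLocalization_stalk ⟨z, hz⟩
    obtain ⟨⟨s, t⟩, hst⟩ := IsLocalization.surj
      (U.2.primeIdealOf ⟨I.subschemeι z, hU⟩).asIdeal.primeCompl a
    have ht := IsLocalization.map_units (X.presheaf.stalk (I.subschemeι z)) t
    have hst' : a * X.presheaf.germ U.1 _ hU t.1 = X.presheaf.germ U.1 _ hU s := hst
    have hs0 : I.subscheme.presheaf.germ (I.subschemeι ⁻¹ᵁ U.1) z hz (I.subschemeι.app U.1 s) =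
        0 := by
      rw [← hgerm, ← hst', map_mul, RingHom.mem_ker.1 ha, zero_mul]
    obtain ⟨c, hc⟩ := (IsLocalization.map_eq_zero_iff
      (hU'.primeIdealOf ⟨z, hz⟩).asIdeal.primeCompl (I.subscheme.presheaf.stalk z) _).1 hs0
    obtain ⟨d, hd⟩ := I.subschemeι_app_surjective U c.1
    have hds : d * s ∈ I.ideal U := by
      rw [← ker_subschemeι_app, RingHom.mem_ker, map_mul]
      exact (congrArg (· * _) hd).trans hc
    have hdu : IsUnit (X.presheaf.germ U.1 _ hU d) := by
      refine isUnit_of_map_unit (I.subschemeι.stalkMap z).hom _ ?_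
      rw [hgerm, hd]
      exact IsLocalization.map_units (I.subscheme.presheaf.stalk z) c
    have hm := Ideal.mem_map_of_mem (X.presheaf.germ U.1 _ hU).hom hds
    rw [map_mul] at hm
    have hm2 := (Ideal.unit_mul_mem_iff_mem _ hdu).1 hm
    rw [← hst'] at hm2
    exact (Ideal.mul_unit_mem_iff_mem _ ht).1 hm2
  · rw [Ideal.map_le_iff_le_comap]
    intro s hs
    rw [← ker_subschemeι_app, RingHom.mem_ker] at hs
    rw [Ideal.mem_comap, RingHom.mem_ker]
    exact (hgerm s).trans ((congrArg _ hs).trans (map_zero _))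

lemma isRegularLocalRing_quotient_stalkIdeal (I : X.IdealSheafData) (hI : I.subscheme.IsRegular)
    {x : X} (hx : x ∈ I.support) :
    IsRegularLocalRing (X.presheaf.stalk x ⧸ I.stalkIdeal x) := by
  have hx' : x ∈ Set.range I.subschemeι := by rwa [range_subschemeι]
  obtain ⟨z, rfl⟩ := hx'
  have := hI z
  rw [← ker_stalkMap_subschemeι]
  exact .of_ringEquiv (RingHom.quotientKerEquivOfSurjective
    (I.subschemeι.stalkMap_surjective z)).symm

/-- An ideal of constant order `b` along a regular center `Z` in a regular scheme is contained in
`I(Z) ^ b`. At a point `x` of `Z`, this holds at the generic point of the component of `Z`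
through `x`, and powers of the ideal of `Z` at `x` are primary. -/
theorem le_pow_of_orderAt_eq (hX : X.IsRegular) {I : X.IdealSheafData} (hI : I.subscheme.IsRegular)
    {J : X.IdealSheafData} {b : ℕ} (hb : ∀ z ∈ I.support, J.orderAt z = b) : J ≤ I ^ b := by
  rw [le_iff_stalkIdeal_le]
  intro x
  rw [stalkIdeal_pow]
  by_cases hx : x ∈ I.support
  swap
  · rw [mem_support_iff_stalkIdeal_le] at hx
    have : I.stalkIdeal x = ⊤ := by
      by_contra h
      exact hx (IsLocalRing.le_maximalIdeal h)
    rw [this, Ideal.top_pow]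
    exact le_top
  have := hX x
  have hreg := isRegularLocalRing_quotient_stalkIdeal I hI hx
  have hdom : IsDomain (X.presheaf.stalk x ⧸ I.stalkIdeal x) := IsRegularLocalRing.isDomain
  have hp : (I.stalkIdeal x).IsPrime := (Ideal.Quotient.isDomain_iff_prime _).1 hdom
  obtain ⟨ι, _, t, ht, hqr⟩ :=
    (IsRegularLocalRing.isRegularlyGenerated (I.stalkIdeal x)).exists_isQuasiRegular
  obtain ⟨U, hU⟩ := exists_affineOpens_mem x
  rw [stalkIdeal_eq J hU, Ideal.map_le_iff_le_comap]
  intro g hg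
  let Q : Ideal Γ(X, U.1) := (I.stalkIdeal x).comap (X.presheaf.germ U.1 x hU).hom
  have hQ : Q.IsPrime := inferInstance
  -- the generic point of the component of the center through `x`
  let η : X := U.2.fromSpec ⟨Q, hQ⟩
  have hη : η ∈ U.1 := by
    have : η ∈ Set.range U.2.fromSpec := ⟨_, rfl⟩
    rwa [U.2.range_fromSpec] at this
  let := X.presheaf.algebra_section_stalk ⟨η, hη⟩
  have hloc : IsLocalization.AtPrime (X.presheaf.stalk η) Q :=
    U.2.isLocalization_stalk' ⟨Q, hQ⟩ hη
  have hmax : Q.map (X.presheaf.germ U.1 η hη).hom =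
      IsLocalRing.maximalIdeal (X.presheaf.stalk η) :=
    IsLocalization.AtPrime.map_eq_maximalIdeal Q (X.presheaf.stalk η)
  have hηI : η ∈ I.support := by
    rw [mem_support_iff_stalkIdeal_le, stalkIdeal_eq I hη, ← hmax]
    refine Ideal.map_mono fun s hs ↦ ?_
    rw [Ideal.mem_comap, stalkIdeal_eq I hU]
    exact Ideal.mem_map_of_mem _ hs
  have hJη := stalkIdeal_le_pow_of_le_orderAt (hb η hηI).ge
  rw [stalkIdeal_eq J hη, ← hmax, ← Ideal.map_pow] at hJη
  obtain ⟨s, hs, hsg⟩ := (IsLocalization.algebraMap_mem_map_algebraMap_iff Q.primeCompl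
    (X.presheaf.stalk η) _ _).1 (hJη (Ideal.mem_map_of_mem _ hg))
  have hsg' : X.presheaf.germ U.1 x hU s * X.presheaf.germ U.1 x hU g ∈ I.stalkIdeal x ^ b := by
    rw [← map_mul]
    have := Ideal.mem_map_of_mem (X.presheaf.germ U.1 x hU).hom hsg
    rw [Ideal.map_pow] at this
    exact Ideal.pow_right_mono Ideal.map_comap_le b this
  rw [Ideal.mem_comap]
  rw [← ht] at hsg' hp ⊢
  refine hqr.mem_pow_of_mul_mem_pow (fun a ha ↦ (hp.mem_or_mem ha).resolve_left ?_) b hsg'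
  rw [ht]
  exact hs

/-! ### Division by an invertible ideal -/

/-- Quotient of ideals commutes with localization when the divisor is finitely generated. -/
lemma _root_.Ideal.map_colon_eq_of_fg {A B : Type u} [CommRing A] [CommRing B] [Algebra A B] (f : A)
    [IsLocalization.Away f B] (I J : Ideal A) (hI : I.FG) :
    (J.colon (I : Set A)).map (algebraMap A B) =
      (J.map (algebraMap A B)).colon ((I.map (algebraMap A B) : Ideal B) : Set B) := by
  refine le_antisymm ?_ ?_
  · rw [Ideal.map_le_iff_le_comap]
    intro a ha
    rw [Ideal.mem_comap, Submodule.mem_colon]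
    intro y hy
    have : I.map (algebraMap A B) ≤
        (J.map (algebraMap A B)).colon {algebraMap A B a} := by
      rw [Ideal.map_le_iff_le_comap]
      intro i hi
      rw [Ideal.mem_comap, Submodule.mem_colon_singleton, smul_eq_mul, ← map_mul, mul_comm]
      exact Ideal.mem_map_of_mem _ (Submodule.mem_colon.1 ha i hi)
    have := Submodule.mem_colon_singleton.1 (this hy)
    rwa [smul_eq_mul, mul_comm] at this
  · intro c hc
    obtain ⟨⟨a, s⟩, hcs⟩ := IsLocalization.surj (Submonoid.powers f) c
    have hs := IsLocalization.map_units B s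
    have hcs : c * algebraMap A B s = algebraMap A B a := hcs
    rw [← Ideal.mul_unit_mem_iff_mem _ hs, hcs]
    obtain ⟨S, rfl⟩ := hI
    have ha : ∀ i ∈ S, ∃ n : ℕ, f ^ n * (a * i) ∈ J := by
      intro i hi
      have h1 : algebraMap A B (a * i) ∈ J.map (algebraMap A B) := by
        rw [map_mul, ← hcs, mul_right_comm]
        refine Ideal.mul_mem_right _ _ (Submodule.mem_colon.1 hc _ ?_)
        exact Ideal.mem_map_of_mem _ (Submodule.subset_span hi)
      obtain ⟨_, ⟨n, rfl⟩, hn⟩ :=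
        (IsLocalization.algebraMap_mem_map_algebraMap_iff (Submonoid.powers f) B _ _).1 h1
      exact ⟨n, hn⟩
    choose! n hn using ha
    have hf : IsUnit (algebraMap A B (f ^ S.sup n)) :=
      IsLocalization.map_units B (⟨f ^ S.sup n, ⟨_, rfl⟩⟩ : Submonoid.powers f)
    rw [← Ideal.unit_mul_mem_iff_mem _ hf, ← map_mul]
    refine Ideal.mem_map_of_mem _ ?_
    have : Submodule.span A (S : Set A) ≤ J.colon {f ^ S.sup n * a} := by
      rw [Submodule.span_le]
      intro i hi
      rw [SetLike.mem_coe, Submodule.mem_colon_singleton, smul_eq_mul,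
        ← Nat.sub_add_cancel (Finset.le_sup (f := n) hi), pow_add]
      convert! J.mul_mem_left (f ^ (S.sup n - n i)) (hn i hi) using 1
      ring
    rw [Submodule.mem_colon]
    intro i hi
    have := Submodule.mem_colon_singleton.1 (this hi)
    rwa [smul_eq_mul, mul_comm] at this

/-- The quotient `(J : I)` of ideal sheaves, where `I` is locally finitely generated. -/
noncomputable def colon (J I : X.IdealSheafData) (hI : ∀ U, (I.ideal U).FG) : X.IdealSheafData where
  ideal U := (J.ideal U).colon (I.ideal U : Set Γ(X, U.1))
  map_ideal_basicOpen U f := by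
    have := U.2.isLocalization_basicOpen f
    have := Ideal.map_colon_eq_of_fg (B := Γ(X, X.basicOpen f)) f (I.ideal U) (J.ideal U) (hI U)
    have h1 := I.map_ideal_basicOpen U f
    have h2 := J.map_ideal_basicOpen U f
    rw [← h1, ← h2]
    exact this

end AlgebraicGeometry.Scheme.IdealSheafData

namespace AlgebraicGeometry.Scheme.IdealSheafData

variable {X : Scheme.{u}}

/-- The sections of an invertible ideal over any affine open set form a finitely generated ideal,
although the generator of the definition exists only on some neighbourhood of each point. -/
lemma IsInvertible.fg {I : X.IdealSheafData} (hI : I.IsInvertible) (U : X.affineOpens) :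
    (I.ideal U).FG := by
  have : ∀ x : U.1, ∃ r : Γ(X, U.1), x.1 ∈ X.basicOpen r ∧ (I.ideal (X.affineBasicOpen r)).FG := by
    intro ⟨x, hx⟩
    obtain ⟨W, hW, h, -, hIW⟩ := hI x
    obtain ⟨r, g, hrg, hxr⟩ := exists_basicOpen_le_affine_inter U.2 W.2 x ⟨hx, hW⟩
    have hle : (X.affineBasicOpen r).1 ≤ W.1 := hrg.trans_le (X.basicOpen_le g)
    refine ⟨r, hxr, ?_⟩
    rw [← I.map_ideal' (V := W) (homOfLE hle).op, hIW]
    exact Ideal.FG.map ⟨{h}, by simp⟩ _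
  choose r hxr hfg using this
  have hspan : Ideal.span (Set.range r) = ⊤ := by
    rw [← U.2.self_le_iSup_basicOpen_iff]
    exact fun x hx ↦ TopologicalSpace.Opens.mem_iSup.mpr ⟨⟨_, _, rfl⟩, hxr ⟨x, hx⟩⟩
  have inst := U.2.isLocalization_basicOpen
  refine Module.Finite.iff_fg.1 ?_
  refine Module.Finite.of_localizationSpan' (Set.range r) hspan
    (Rₚ := fun g ↦ Γ(X, X.basicOpen g.1))
    (fun g ↦ Algebra.idealMap (I.ideal U) (S := Γ(X, X.basicOpen g.1))) ?_
  rintro ⟨_, x, rfl⟩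
  refine Module.Finite.of_fg ?_
  have h1 := I.map_ideal_basicOpen U (r x)
  have h2 := hfg x
  rw [← h1] at h2
  exact h2

lemma IsInvertible.pow {I : X.IdealSheafData} (hI : I.IsInvertible) (n : ℕ) :
    (I ^ n).IsInvertible := by
  intro x
  obtain ⟨U, hU, f, hf, hIf⟩ := hI x
  refine ⟨U, hU, f ^ n, pow_mem hf n, ?_⟩
  rw [ideal_pow, Pi.pow_apply, hIf, Ideal.span_singleton_pow]

lemma _root_.Ideal.le_of_span_singleton_mul_le {A : Type*} [CommRing A] {h : A}
    (hh : h ∈ nonZeroDivisors A) {K L : Ideal A}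
    (hKL : Ideal.span {h} * K ≤ Ideal.span {h} * L) : K ≤ L := by
  intro a ha
  obtain ⟨c, hc, hca⟩ := Ideal.mem_span_singleton_mul.1
    (hKL (Ideal.mem_span_singleton_mul.2 ⟨a, ha, rfl⟩))
  have : h * (c - a) = 0 := by rw [mul_sub, hca, sub_self]
  rwa [← sub_eq_zero.1 ((mem_nonZeroDivisors_iff.1 hh).1 _ this)]

/-- An ideal sheaf contained in an invertible one is uniquely divisible by it; the quotient is the
ideal quotient `(J : I)`. -/
theorem IsInvertible.existsUnique_eq_mul {I J : X.IdealSheafData} (hI : I.IsInvertible)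
    (hJ : J ≤ I) : ∃! K : X.IdealSheafData, J = I * K := by
  have hmul : J = I * J.colon I hI.fg := by
    have hI' := hI
    choose U hU f hf hIf using hI'
    refine ext_of_iSup_eq_top U ?_ fun x ↦ ?_
    · exact top_le_iff.1 fun x _ ↦ TopologicalSpace.Opens.mem_iSup.2 ⟨x, hU x⟩
    change J.ideal (U x) = I.ideal (U x) * (J.ideal (U x)).colon (I.ideal (U x) : Set _)
    have hle := hJ (U x)
    rw [hIf] at hle ⊢
    refine le_antisymm (fun a ha ↦ ?_) fun a ha ↦ ?_
    · obtain ⟨c, rfl⟩ := Ideal.mem_span_singleton.1 (hle ha)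
      refine Ideal.mem_span_singleton_mul.2 ⟨c, Submodule.mem_colon.2 fun y hy ↦ ?_, rfl⟩
      obtain ⟨d, rfl⟩ := Ideal.mem_span_singleton.1 hy
      rw [smul_eq_mul, mul_left_comm, ← mul_assoc]
      exact Ideal.mul_mem_right _ _ ha
    · obtain ⟨c, hc, rfl⟩ := Ideal.mem_span_singleton_mul.1 ha
      rw [mul_comm]
      exact Submodule.mem_colon.1 hc _ (Ideal.mem_span_singleton_self _)
  have cancel : ∀ {K L : X.IdealSheafData}, I * K = I * L → K ≤ L := by
    intro K L h
    rw [le_iff_stalkIdeal_le]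
    intro x
    obtain ⟨h', hh', hIh⟩ := hI.exists_stalkIdeal_eq x
    have := congr(stalkIdeal $h x)
    rw [stalkIdeal_mul, stalkIdeal_mul, hIh] at this
    exact Ideal.le_of_span_singleton_mul_le hh' this.le
  exact ⟨_, hmul, fun K hK ↦
    le_antisymm (cancel (hK.symm.trans hmul)) (cancel (hmul.symm.trans hK))⟩

end AlgebraicGeometry.Scheme.IdealSheafData

/-! ### Local rings of a blowup -/

namespace AlgebraicGeometry.Scheme

variable {X Y : Scheme.{u}}

lemma exists_stalk_hom_of_apply_closedPoint_eq {A : CommRingCat.{u}} [IsLocalRing A]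
    (g : Spec A ⟶ X) {x : X} (hx : g (IsLocalRing.closedPoint A) = x) :
    ∃ γ : X.presheaf.stalk x ⟶ A, IsLocalHom γ.hom ∧ Spec.map γ ≫ X.fromSpecStalk x = g := by
  subst hx
  exact ⟨stalkClosedPointTo g, inferInstance, Spec_stalkClosedPointTo_fromSpecStalk g⟩

open IdealSheafData in
/-- Let `π : X ⟶ Y` be a blowup and let `𝒪_{Y, π x} → A → 𝒪_{X, x}` be a factorization of the
stalk map through a local ring `A` in which the center becomes invertible, with `A → 𝒪_{X, x}`
local. Then `A` receives a local homomorphism from `𝒪_{X, x}` over `𝒪_{Y, π x}`. It comes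
from the lift `Spec A ⟶ X`, which passes through `x` because the lift of `Spec 𝒪_{X, x} ⟶ Y`
is unique. -/
theorem IsBlowup.exists_stalk_hom {π : X ⟶ Y} {I : Y.IdealSheafData} (hπ : IsBlowup π I) (x : X)
    {A : CommRingCat.{u}} [IsLocalRing A] (α : Y.presheaf.stalk (π x) ⟶ A)
    (β : A ⟶ X.presheaf.stalk x) [IsLocalHom β.hom] (hαβ : α ≫ β = π.stalkMap x)
    {h : A} (hh : h ∈ nonZeroDivisors A) (hI : (I.stalkIdeal (π x)).map α.hom = Ideal.span {h}) :
    ∃ γ : X.presheaf.stalk x ⟶ A, IsLocalHom γ.hom ∧ π.stalkMap x ≫ γ = α := by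
  obtain ⟨g, hg, -⟩ := hπ.existsUnique_lift (Spec.map α ≫ Y.fromSpecStalk (π x))
    (isInvertible_comap_fromSpecStalk I (π x) α hh hI)
  have hcomm : Spec.map (π.stalkMap x) ≫ Y.fromSpecStalk (π x) = X.fromSpecStalk x ≫ π :=
    SpecMap_stalkMap_fromSpecStalk π
  obtain ⟨h', hh', hIh'⟩ := hπ.isInvertible_comap.exists_stalkIdeal_eq x
  rw [stalkIdeal_comap] at hIh'
  have huniq := (hπ.existsUnique_lift _ (isInvertible_comap_fromSpecStalk I (π x)
    (π.stalkMap x) hh' hIh')).unique (y₁ := Spec.map β ≫ g) (y₂ := X.fromSpecStalk x)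
    (by rw [Category.assoc, hg, ← Spec.map_comp_assoc, hαβ]) hcomm.symm
  have hx : g (IsLocalRing.closedPoint A) = x := by
    have h1 : (Spec.map β ≫ g) (IsLocalRing.closedPoint (X.presheaf.stalk x)) = x := by
      rw [huniq]
      exact fromSpecStalk_closedPoint
    have h2 : Spec.map β (IsLocalRing.closedPoint (X.presheaf.stalk x)) =
        IsLocalRing.closedPoint A := Spec_closedPoint
    exact (congrArg g h2).symm.trans h1
  obtain ⟨γ, hγ, rfl⟩ := exists_stalk_hom_of_apply_closedPoint_eq g hx
  refine ⟨γ, hγ, ?_⟩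
  rw [Category.assoc, ← hcomm, ← Spec.map_comp_assoc, cancel_mono] at hg
  exact Spec.map_injective hg

end AlgebraicGeometry.Scheme

open Scheme.IdealSheafData in
theorem theorem1p7 (p : ℕ) [Fact p.Prime]
    (V : Scheme.{u}) [IsNoetherian V] [IrreducibleSpace V]
    (hV : V.IsRegular) (hF : V.IsFFinite p)
    -- the regular center `Z`, given by its ideal
    (IZ : V.IdealSheafData) (hZ : IZ.subscheme.IsRegular)
    (J : V.IdealSheafData) (b : ℕ)
    (hb : ∀ z ∈ IZ.support, J.orderAt z = b)
    (V₁ : Scheme.{u}) (π : V₁ ⟶ V) (hπ : Scheme.IsBlowup π IZ) :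
    (∃! J₁ : V₁.IdealSheafData, J.comap π = (IZ.comap π) ^ b * J₁) ∧
      ∀ J₁ : V₁.IdealSheafData, J.comap π = (IZ.comap π) ^ b * J₁ →
        ∀ x₁ : V₁, J₁.orderAt x₁ ≤ J.orderAt (π x₁) := by
  have hJ : J ≤ IZ ^ b := le_pow_of_orderAt_eq hV hZ hb
  refine ⟨(hπ.isInvertible_comap.pow b).existsUnique_eq_mul
    ((comap_mono π hJ).trans (comap_pow IZ π b).le), fun J₁ hJ₁ x ↦ ?_⟩
  refine orderAt_le fun n hn ↦ ?_
  -- every local ring `A` dominating the situation as in `IsBlowup.exists_stalk_hom` bounds `n`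
  have key : ∀ {A : CommRingCat.{u}} [IsLocalRing A] (α : V.presheaf.stalk (π x) ⟶ A)
      (β : A ⟶ V₁.presheaf.stalk x) [IsLocalHom β.hom] (_ : α ≫ β = π.stalkMap x)
      {h : A} (_ : h ∈ nonZeroDivisors A)
      (_ : (IZ.stalkIdeal (π x)).map α.hom = Ideal.span {h}),
      (J.stalkIdeal (π x)).map α.hom ≤
        Ideal.span {h ^ b} * IsLocalRing.maximalIdeal A ^ n := by
    intro A _ α β _ hαβ h hh hIh
    obtain ⟨γ, hγ, hγα⟩ := hπ.exists_stalk_hom x α β hαβ hh hIh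
    have h1 := congr(((stalkIdeal $hJ₁ x).map γ.hom))
    rw [stalkIdeal_mul, stalkIdeal_pow, stalkIdeal_comap, stalkIdeal_comap, Ideal.map_mul,
      Ideal.map_pow, Ideal.map_map, Ideal.map_map, ← CommRingCat.hom_comp, hγα, hIh,
      Ideal.span_singleton_pow] at h1
    rw [h1]
    refine Ideal.mul_mono_right ((Ideal.map_mono hn).trans ?_)
    rw [Ideal.map_pow]
    exact Ideal.pow_right_mono (IsLocalRing.map_maximalIdeal_le γ.hom) n
  by_cases hx : π x ∈ IZ.support
  swap
  -- away from the center, take `A` to be the local ring of `V`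
  · have htop : IZ.stalkIdeal (π x) = ⊤ := by
      by_contra hne
      exact hx ((mem_support_iff_stalkIdeal_le _ _).2 (IsLocalRing.le_maximalIdeal hne))
    have := key (𝟙 _) (π.stalkMap x) (Category.id_comp _) (h := 1) (one_mem _)
      (by rw [htop, Ideal.map_top, Ideal.span_singleton_one])
    refine natCast_le_orderAt ?_
    simpa [Ideal.span_singleton_one, Ideal.one_eq_top] using! this
  -- on the center, take `A` in a chart of the blowup of a regular sequence
  rw [hb _ hx]
  have := hV (π x)
  have hreg := isRegularLocalRing_quotient_stalkIdeal IZ hZ hx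
  have hdom : IsDomain (V.presheaf.stalk (π x)) := IsRegularLocalRing.isDomain
  obtain ⟨ι, _, t, ht, hqr⟩ :=
    (IsRegularLocalRing.isRegularlyGenerated (IZ.stalkIdeal (π x))).exists_isQuasiRegular
  obtain ⟨h', hh', hIh'⟩ := hπ.isInvertible_comap.exists_stalkIdeal_eq x
  rw [stalkIdeal_comap, ← ht] at hIh'
  obtain ⟨A, _, _, α, β, h, hβ, hαβ, hh, hIh, hA⟩ := exists_localRing_of_isQuasiRegular
    (π.stalkMap x).hom t hqr (ht ▸ (mem_support_iff_stalkIdeal_le _ _).1 hx) hh' hIh'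
  obtain ⟨f, hfJ, hf⟩ : ∃ f ∈ J.stalkIdeal (π x),
      f ∉ IsLocalRing.maximalIdeal (V.presheaf.stalk (π x)) ^ (b + 1) := by
    by_contra! hcon
    have := natCast_le_orderAt (J := J) (x := π x) (n := b + 1) hcon
    rw [hb _ hx] at this
    norm_cast at this
    omega
  have hfI := le_iff_stalkIdeal_le.1 hJ (π x) hfJ
  rw [stalkIdeal_pow, ← ht] at hfI
  obtain ⟨G, hG, rfl⟩ := (Ideal.mem_span_pow_iff_exists_isHomogeneous t f).1 hfI
  have hle := key (A := .of A) (CommRingCat.ofHom α) (CommRingCat.ofHom β)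
    (CommRingCat.hom_ext hαβ) hh (ht ▸ hIh)
  obtain ⟨a, ha, hfa⟩ := Ideal.mem_span_singleton_mul.1 (hle (Ideal.mem_map_of_mem _ hfJ))
  refine Nat.cast_le.2 (hA b n G a hG ?_ hfa.symm ha)
  by_contra! hcoef
  refine hf ?_
  rw [pow_succ']
  refine Ideal.mul_mono_right (Ideal.pow_right_mono ?_ b)
    (IsQuasiRegular.eval_mem_mul t _ hG hcoef)
  exact ht ▸ (mem_support_iff_stalkIdeal_le _ _).1 hx
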